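/- For an algebraic number $\alpha$ let $H(\alpha)$ be the maximum of the absolute values of the coefficients of its minimal polynomial over $\mathbb{Z}$. For a number $z$ and $n\ge 1$ let $\omega^*_n(z)\in[0,\infty]$ be the supremum of the positive reals $\omega^*$ for which there are infinitely many algebraic numbers $\alpha$ of degree $n$ with $0<|z-\alpha|<H(\alpha)^{-\omega^*-1}$, where $\alpha$ ranges over real numbers if $z$ is regarded as an element of $\mathbb{R}$ and over complex numbers if $z$ is regarded as an element of $\mathbb{C}$. The number $z$ is a $U_m$-number if $\omega^*_m(z)=\infty$ and $\omega^*_n(z)<\infty$ for all $1\le n<m$. Let $\mathcal{L}$ be the set of Liouville numbers $\xi$ for which there are positive real numbers $\omega_n\to\infty$, pairwise distinct rational numbers $r_n$ and a constant $C>0$ such that $$|\xi-r_n|<H(r_n)^{-\omega_n}\quad\text{and}\quad H(r_{n+1})\le H(r_n)^{C\omega_n}\qquad\text{for all } n.$$ Let $a\ge 2$ be an integer, let $(v_n)_{n\ge1}$ be positive integers with $v_{n+1}/v_n\to\infty$, and let $\xi=\sum_{n\ge1}a^{-v_n}$. Then $\xi\in\mathcal{L}$. Moreover, let $K$ be a number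 field of degree $m$ embedded in $\mathbb{R}$ or in $\mathbb{C}$, and let $F\in K(x)$ be a non-constant rational function that does not lie in $L(x)$ for any proper subfield $L\subsetneq K$ (that is, when $F$ is written as a quotient of coprime polynomials with monic denominator, its coefficients generate $K$ over $\mathbb{Q}$). Then $\xi$ is not a pole of $F$ and $F(\xi)$ is a $U_m$-number, in $\mathbb{R}$ or in $\mathbb{C}$ respectively. -/

import Mathlib

open Filter Topology Polynomial

noncomputable section

namespace UNumbers

/-- The minimal polynomial over `ℤ` of an algebraic number `α`: the primitive integer polynomial
proportional to the monic minimal polynomial of `α` over `ℚ` (it is determined up to sign). -/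
def intMinpoly {A : Type*} [Field A] [Algebra ℚ A] (α : A) : ℤ[X] :=
  (IsLocalization.integerNormalization (nonZeroDivisors ℤ) (minpoly ℚ α)).primPart

/-- The height `H(α)` of an algebraic number `α`: the maximum of the absolute values of the
coefficients of its minimal polynomial over `ℤ`. -/
def height {A : Type*} [Field A] [Algebra ℚ A] (α : A) : ℕ :=
  (intMinpoly α).support.sup fun i => ((intMinpoly α).coeff i).natAbs

/-- The algebraic numbers `α ∈ 𝕜` of degree exactly `n` with `0 < |z - α| < H(α) ^ (-w - 1)`. -/
def approximants {𝕜 : Type*} [RCLike 𝕜] (n : ℕ) (z : 𝕜) (w : ℝ) : Set 𝕜 :=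
  {α : 𝕜 | IsAlgebraic ℚ α ∧ (minpoly ℚ α).natDegree = n ∧
    0 < ‖z - α‖ ∧ ‖z - α‖ < (height α : ℝ) ^ (-w - 1)}

/-- Koksma's exponent `ω*_n(z)`: the supremum, in `[0, ∞]`, of the positive real numbers `w` for
which there are infinitely many algebraic numbers `α` of degree `n` satisfying
`0 < |z - α| < H(α) ^ (-w - 1)`.  For `𝕜 = ℝ` the approximants `α` are real, for `𝕜 = ℂ` they are
complex. -/
def omegaStar {𝕜 : Type*} [RCLike 𝕜] (n : ℕ) (z : 𝕜) : ENNReal :=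
  ⨆ w ∈ {w : ℝ | 0 < w ∧ (approximants n z w).Infinite}, ENNReal.ofReal w

/-- `z` is a `U_m`-number: `ω*_m(z) = ∞` and `ω*_n(z) < ∞` for all `1 ≤ n < m`. -/
def IsUNumber {𝕜 : Type*} [RCLike 𝕜] (m : ℕ) (z : 𝕜) : Prop :=
  omegaStar m z = ⊤ ∧ ∀ n, 1 ≤ n → n < m → omegaStar n z < ⊤

/-- The class `𝓛`: the Liouville numbers `ξ` for which there are positive real numbers `ω n`
tending to infinity, and a sequence `r` of pairwise distinct rational numbers, such that
`|ξ - r n| < H(r n) ^ (-ω n)` and `H(r (n + 1)) ≤ H(r n) ^ O(ω n)` for all `n`. -/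
def classL : Set ℝ :=
  {ξ : ℝ | Liouville ξ ∧ ∃ (ω : ℕ → ℝ) (r : ℕ → ℚ),
    (∀ n, 0 < ω n) ∧ Tendsto ω atTop atTop ∧ Function.Injective r ∧
    (∀ n, |ξ - (r n : ℝ)| < (height (r n) : ℝ) ^ (-ω n)) ∧
    ∃ C : ℝ, 0 < C ∧ ∀ n, (height (r (n + 1)) : ℝ) ≤ (height (r n) : ℝ) ^ (C * ω n)}

/-- The subfield of `K` generated over `ℚ` by the coefficients of `F`, where `F` is written as a
quotient of coprime polynomials with monic denominator.  It is the smallest subfield `L` of `K`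
with `F ∈ L(x)`. -/
def coeffField {K : Type*} [Field K] [Algebra ℚ K] (F : RatFunc K) : IntermediateField ℚ K :=
  IntermediateField.adjoin ℚ ((F.num.coeffs : Set K) ∪ (F.denom.coeffs : Set K))

end UNumbers

end

noncomputable section

namespace UNumbers

/-! ### Heights of algebraic numbers. -/

section Height

variable {A : Type*} [Field A] [Algebra ℚ A]

/-! Let r_k be the partial sums of ξ, from a late index on, and q_k = a^{u_k} their denominators.
Then |ξ - r_k| ≤ 2/q_{k+1}, and q_{k+1} eventually exceeds every fixed power of q_k. Hence ξ is
Liouville, so transcendental, and no conjugate of F has a pole at ξ. It lies in 𝓛 because H(r_k) is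
between q_k^{1/2} and q_k^2 for k ≥ 1.

The approximants to F(ξ) are α_k = F(r_k) ∈ K. They satisfy |F(ξ) - α_k| ≪ 1/q_{k+1}, their
conjugates stay bounded, and they have denominators ≪ q_k^E (`exists_denominator_bound`). All but
finitely many have degree exactly m: K has finitely many subfields, and F takes values in a given
proper one at only finitely many rationals (`coeffField_le_of_infinite`). So H(α_k) is polynomially
bounded in q_k, and ω*_m = ∞.

Let β have degree n < m. Its minimal polynomial does not vanish at α_k, and a nonzero algebraic
integer with bounded conjugates cannot be too small, so |α_k - β| ≫ H(β)^{-M} q_k^{-EN}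
(`one_le_norm_sub_mul`). The first k for which the error 1/q_{k+1} is negligible against this has
q_k polynomially bounded in H(β) (`exists_index_of_growth`). Hence |F(ξ) - β| is at least a fixed
negative power of H(β), up to a constant, and ω*_n < ∞. Both halves are combined in
`isUNumber_of_approx`. -/

theorem exists_map_intMinpoly {α : A} (hα : IsAlgebraic ℚ α) :
    ∃ u : ℚ, u ≠ 0 ∧ (intMinpoly α).map (algebraMap ℤ ℚ) = C u * minpoly ℚ α := by
  obtain ⟨b, hbm, hb⟩ := IsLocalization.integerNormalization_spec (nonZeroDivisors ℤ)
    (minpoly ℚ α)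
  set N := IsLocalization.integerNormalization (nonZeroDivisors ℤ) (minpoly ℚ α) with hN
  have hb0 : b ≠ 0 := nonZeroDivisors.ne_zero hbm
  have hm : minpoly ℚ α ≠ 0 := minpoly.ne_zero hα.isIntegral
  have hN0 : N ≠ 0 := by
    intro h
    rw [h, Polynomial.map_zero, eq_comm, smul_eq_zero] at hb
    exact hb.elim hb0 hm
  have hc : N.content ≠ 0 := by rwa [Ne, content_eq_zero_iff]
  have hc' : (N.content : ℚ) ≠ 0 := by exact_mod_cast hc
  refine ⟨(b : ℚ) / N.content, div_ne_zero (by exact_mod_cast hb0) hc', ?_⟩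
  have h1 : C (N.content : ℚ) * (intMinpoly α).map (algebraMap ℤ ℚ) =
      C (b : ℚ) * minpoly ℚ α := by
    have := congrArg (Polynomial.map (algebraMap ℤ ℚ)) N.eq_C_content_mul_primPart
    rw [Polynomial.map_mul, Polynomial.map_C, hb] at this
    rw [intMinpoly, ← hN]
    simp only [algebraMap_int_eq, eq_intCast] at this
    rw [algebraMap_int_eq, ← this, ← smul_eq_C_mul, Int.cast_smul_eq_zsmul]
  apply mul_left_cancel₀ (C_ne_zero.mpr hc')
  rw [h1, ← mul_assoc, ← C_mul, mul_div_cancel₀ _ hc']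

theorem intMinpoly_ne_zero {α : A} (hα : IsAlgebraic ℚ α) : intMinpoly α ≠ 0 := by
  obtain ⟨u, hu, h⟩ := exists_map_intMinpoly hα
  intro h0
  rw [h0, Polynomial.map_zero, eq_comm, mul_eq_zero, C_eq_zero] at h
  exact h.elim hu (minpoly.ne_zero hα.isIntegral)

theorem natDegree_intMinpoly {α : A} (hα : IsAlgebraic ℚ α) :
    (intMinpoly α).natDegree = (minpoly ℚ α).natDegree := by
  obtain ⟨u, hu, h⟩ := exists_map_intMinpoly hα
  rw [← natDegree_map_eq_of_injective (algebraMap ℤ ℚ).injective_int, h, natDegree_C_mul hu]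

theorem aeval_intMinpoly {α : A} (hα : IsAlgebraic ℚ α) : aeval α (intMinpoly α) = 0 := by
  obtain ⟨u, hu, h⟩ := exists_map_intMinpoly hα
  rw [← aeval_map_algebraMap ℚ, h, map_mul, minpoly.aeval, mul_zero]

theorem natAbs_coeff_intMinpoly_le (α : A) (i : ℕ) :
    ((intMinpoly α).coeff i).natAbs ≤ height α := by
  by_cases hi : i ∈ (intMinpoly α).support
  · exact Finset.le_sup (f := fun i => ((intMinpoly α).coeff i).natAbs) hi
  · simp [notMem_support_iff.mp hi]

theorem one_le_height {α : A} (hα : IsAlgebraic ℚ α) : 1 ≤ height α := by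
  have h := natAbs_coeff_intMinpoly_le α (intMinpoly α).natDegree
  have h0 := leadingCoeff_ne_zero.mpr (intMinpoly_ne_zero hα)
  rw [← leadingCoeff] at h
  omega

/-- By Gauss's lemma the primitive polynomial `intMinpoly α` divides `Q` over ℤ. The degree bound
makes the cofactor a nonzero integer, which can only enlarge coefficients. -/
theorem height_le_of_aeval_eq_zero {α : A} (hα : IsAlgebraic ℚ α) {Q : ℤ[X]} (hQ : Q ≠ 0)
    (hdeg : Q.natDegree ≤ (minpoly ℚ α).natDegree) (hroot : aeval α Q = 0) {B : ℕ}
    (hB : ∀ i, (Q.coeff i).natAbs ≤ B) : height α ≤ B := by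
  obtain ⟨t, ht, h⟩ := exists_map_intMinpoly hα
  have hQm : minpoly ℚ α ∣ Q.map (algebraMap ℤ ℚ) :=
    minpoly.dvd _ _ (by rwa [aeval_map_algebraMap])
  have hdvd : (intMinpoly α) ∣ Q := by
    have hprim : (intMinpoly α).IsPrimitive := isPrimitive_primPart _
    rw [IsPrimitive.Int.dvd_iff_map_cast_dvd_map_cast _ _ hprim, ← algebraMap_int_eq, h]
    exact (IsUnit.mul_left_dvd (isUnit_C.mpr ht.isUnit)).mpr hQm
  obtain ⟨R, hR⟩ := hdvd
  have hR0 : R ≠ 0 := by rintro rfl; simp_all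
  have hRdeg : R.natDegree = 0 := by
    rw [hR, natDegree_mul (intMinpoly_ne_zero hα) hR0, natDegree_intMinpoly hα] at hdeg
    omega
  obtain ⟨c, rfl⟩ := natDegree_eq_zero.mp hRdeg
  have hc : c ≠ 0 := by rintro rfl; simp at hR0
  refine Finset.sup_le fun i _ => le_trans ?_ (hB i)
  rw [hR, coeff_mul_C, Int.natAbs_mul]
  exact Nat.le_mul_of_pos_right _ (Int.natAbs_pos.mpr hc)

/-- Northcott's finiteness: there are finitely many integer polynomials of bounded degree and
coefficients, each with finitely many roots. -/
theorem finite_height_le (n B : ℕ) :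
    {α : A | IsAlgebraic ℚ α ∧ (minpoly ℚ α).natDegree = n ∧ height α ≤ B}.Finite := by
  classical
  have := charZero_of_injective_algebraMap (algebraMap ℚ A).injective
  refine (bUnion_roots_finite (algebraMap ℤ A) n (Set.finite_Icc (-(B : ℤ)) B)).subset ?_
  rintro α ⟨hα, hd, hB⟩
  simp only [Set.mem_iUnion]
  refine ⟨intMinpoly α, ⟨by rw [natDegree_intMinpoly hα, hd], fun i => ?_⟩, ?_⟩
  · have := (natAbs_coeff_intMinpoly_le α i).trans hB
    rw [Set.mem_Icc]
    omega
  · rw [Finset.mem_coe, Multiset.mem_toFinset, mem_roots', IsRoot, eval_map_algebraMap]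
    exact ⟨(Polynomial.map_ne_zero_iff (algebraMap ℤ A).injective_int).mpr (intMinpoly_ne_zero hα),
      aeval_intMinpoly hα⟩

theorem height_algHom {B : Type*} [Field B] [Algebra ℚ B] (f : A →ₐ[ℚ] B) (α : A) :
    height (f α) = height α := by
  rw [height, height, intMinpoly, intMinpoly, minpoly.algHom_eq f f.injective]

end Height

/-! ### Integrality and size estimates in a number field. -/

section NumberField

variable {K : Type*} [Field K] [NumberField K]

open Module in
theorem natAbs_coeff_minpoly_le {γ : K} (hγ : IsIntegral ℤ γ) {B : ℝ} (hB1 : 1 ≤ B)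
    (hB : ∀ τ : K →+* ℂ, ‖τ γ‖ ≤ B) (i : ℕ) :
    (((minpoly ℤ γ).coeff i).natAbs : ℝ) ≤ 2 ^ finrank ℚ K * B ^ finrank ℚ K := by
  have h := NumberField.Embeddings.coeff_bdd_of_norm_le hB i
  rw [minpoly.isIntegrallyClosed_eq_field_fractions' ℚ hγ, coeff_map, eq_intCast,
    Int.norm_cast_rat, Int.norm_eq_abs, max_eq_left hB1] at h
  rw [Nat.cast_natAbs, Int.cast_abs]
  refine h.trans ?_
  rw [mul_comm]
  gcongr
  exact_mod_cast Nat.choose_le_two_pow _ _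

theorem natDegree_minpoly_le {γ : K} (hγ : IsIntegral ℤ γ) :
    (minpoly ℤ γ).natDegree ≤ Module.finrank ℚ K := by
  have h := minpoly.natDegree_le (A := ℚ) γ
  rwa [minpoly.isIntegrallyClosed_eq_field_fractions' ℚ hγ,
    natDegree_map_eq_of_injective (algebraMap ℤ ℚ).injective_int] at h

omit [NumberField K] in
theorem coeff_zero_minpoly_ne_zero [CharZero K] {γ : K} (hγ : IsIntegral ℤ γ) (h0 : γ ≠ 0) :
    (minpoly ℤ γ).coeff 0 ≠ 0 := by
  have h := minpoly.coeff_zero_ne_zero (A := ℚ) hγ.tower_top h0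
  rw [minpoly.isIntegrallyClosed_eq_field_fractions' ℚ hγ, coeff_map] at h
  exact fun h1 => h (by rw [h1, map_zero])

/-- The constant coefficient of the minimal polynomial of `γ` is `γ` times an integer polynomial in
`γ`, and it is bounded through the conjugates. This serves to clear the denominator of a quotient.
-/
theorem exists_nat_multiple {γ : K} (hγ : IsIntegral ℤ γ) (h0 : γ ≠ 0) {B : ℝ} (hB1 : 1 ≤ B)
    (hB : ∀ τ : K →+* ℂ, ‖τ γ‖ ≤ B) :
    ∃ N : ℕ, 1 ≤ N ∧ (N : ℝ) ≤ 2 ^ Module.finrank ℚ K * B ^ Module.finrank ℚ K ∧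
      IsIntegral ℤ ((N : K) / γ) := by
  refine ⟨((minpoly ℤ γ).coeff 0).natAbs,
    Int.natAbs_pos.mpr (coeff_zero_minpoly_ne_zero hγ h0),
    natAbs_coeff_minpoly_le hγ hB1 hB 0, ?_⟩
  have h1 : ((minpoly ℤ γ).coeff 0 : K) / γ = - aeval γ (minpoly ℤ γ).divX := by
    have h2 := minpoly.aeval ℤ γ
    rw [← divX_mul_X_add (minpoly ℤ γ)] at h2
    rw [map_add, map_mul, aeval_X, aeval_C, algebraMap_int_eq, eq_intCast] at h2
    rw [div_eq_iff h0]
    linear_combination h2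
  have h3 : IsIntegral ℤ (((minpoly ℤ γ).coeff 0 : K) / γ) := by
    rw [h1]
    exact (IsIntegral.of_mem_of_fg _ hγ.fg_adjoin_singleton _ (aeval_mem_adjoin_singleton _ _)).neg
  rcases Int.natAbs_eq ((minpoly ℤ γ).coeff 0) with h | h
  · rw [h] at h3
    simpa using h3
  · rw [h] at h3
    simpa [neg_div] using h3.neg

/-- The constant coefficient of the minimal polynomial is a nonzero integer, and it equals `-γ`
times a polynomial in `γ` with bounded coefficients. When `‖σ γ‖ < 1` that cofactor is bounded, so
`‖σ γ‖` cannot be small. Working with the single embedding `σ` treats ℝ and ℂ alike. -/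
theorem one_le_norm_mul {𝕜 : Type*} [RCLike 𝕜] (σ : K →+* 𝕜) {γ : K} (hγ : IsIntegral ℤ γ)
    (h0 : γ ≠ 0) {B : ℝ} (hB1 : 1 ≤ B) (hB : ∀ τ : K →+* ℂ, ‖τ γ‖ ≤ B) :
    1 ≤ ‖σ γ‖ * ((Module.finrank ℚ K + 1) * (2 ^ Module.finrank ℚ K * B ^ Module.finrank ℚ K)) := by
  set m := Module.finrank ℚ K with hm
  set Q := minpoly ℤ γ with hQ
  have hc := natAbs_coeff_minpoly_le hγ hB1 hB
  rw [← hm, ← hQ] at hc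
  have hD : 1 ≤ (2 : ℝ) ^ m * B ^ m :=
    one_le_mul_of_one_le_of_one_le (one_le_pow₀ one_le_two) (one_le_pow₀ hB1)
  set D := (2 : ℝ) ^ m * B ^ m
  rcases le_or_gt 1 ‖σ γ‖ with h1 | h1
  · have : (1 : ℝ) ≤ (m + 1) * D :=
      one_le_mul_of_one_le_of_one_le (by linarith [m.cast_nonneg (α := ℝ)]) hD
    exact one_le_mul_of_one_le_of_one_le h1 this
  have hroot : (Q.coeff 0 : 𝕜) =
      - (σ γ * ∑ i ∈ Finset.range (m + 1), (Q.coeff (i + 1) : 𝕜) * σ γ ^ i) := by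
    have h2 : aeval γ Q = 0 := minpoly.aeval ℤ γ
    rw [← divX_mul_X_add Q] at h2
    have hdeg : Q.divX.natDegree < m + 1 := by
      rw [natDegree_divX_eq_natDegree_tsub_one]
      exact Nat.lt_succ_of_le ((Nat.sub_le _ _).trans (natDegree_minpoly_le hγ))
    rw [map_add, map_mul, aeval_X, aeval_C, aeval_eq_sum_range' hdeg] at h2
    have h3 := congrArg σ h2
    simp only [coeff_divX, zsmul_eq_mul, map_add, map_mul, map_sum, map_pow, map_intCast,
      algebraMap_int_eq, eq_intCast, map_zero] at h3
    linear_combination h3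
  have h4 : (1 : ℝ) ≤ ‖(Q.coeff 0 : 𝕜)‖ := by
    rw [← RCLike.ofReal_intCast, RCLike.norm_ofReal]
    exact_mod_cast Int.one_le_abs (coeff_zero_minpoly_ne_zero hγ h0)
  refine h4.trans ?_
  rw [hroot, norm_neg, norm_mul]
  gcongr
  refine (norm_sum_le_of_le (n := fun i => D) _ fun i _ => ?_).trans (by simp)
  rw [norm_mul, norm_pow, ← RCLike.ofReal_intCast, RCLike.norm_ofReal]
  have h5 := hc (i + 1)
  rw [Nat.cast_natAbs, Int.cast_abs] at h5
  calc _ ≤ D * 1 := by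
        gcongr
        exact pow_le_one₀ (norm_nonneg _) h1.le
    _ = D := mul_one D

omit [NumberField K] in
theorem isIntegral_pow_mul_aeval {α : K} {T : ℕ} (hT : IsIntegral ℤ ((T : K) * α)) {P : ℤ[X]}
    {n : ℕ} (hP : P.natDegree ≤ n) : IsIntegral ℤ ((T : K) ^ n * aeval α P) := by
  rw [aeval_eq_sum_range' (Nat.lt_succ_of_le hP), Finset.mul_sum]
  refine IsIntegral.sum _ fun i hi => ?_
  obtain ⟨j, rfl⟩ := Nat.exists_eq_add_of_le (Nat.lt_succ_iff.mp (Finset.mem_range.mp hi))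
  have : (T : K) ^ (i + j) * P.coeff i • α ^ i =
      algebraMap ℤ K (P.coeff i * T ^ j) * ((T : K) * α) ^ i := by
    simp only [zsmul_eq_mul, algebraMap_int_eq, eq_intCast, Int.cast_mul, Int.cast_pow,
      Int.cast_natCast]
    ring
  rw [this]
  exact isIntegral_algebraMap.mul (hT.pow i)

theorem norm_aeval_le {E : Type*} [RCLike E] {x : E} {c H : ℝ} (hc : 1 ≤ c)
    (hx : ‖x‖ ≤ c) {P : ℤ[X]} {n : ℕ} (hP : P.natDegree ≤ n)
    (hH : ∀ i, ((P.coeff i).natAbs : ℝ) ≤ H) : ‖aeval x P‖ ≤ (n + 1) * (H * c ^ n) := by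
  rw [aeval_eq_sum_range' (Nat.lt_succ_of_le hP)]
  refine (norm_sum_le_of_le (n := fun _ => H * c ^ n) _ fun i hi => ?_).trans (by simp)
  have hi' := Nat.lt_succ_iff.mp (Finset.mem_range.mp hi)
  have h := hH i
  rw [Nat.cast_natAbs, Int.cast_abs] at h
  have hH0 : 0 ≤ H := (abs_nonneg _).trans h
  rw [zsmul_eq_mul, norm_mul, norm_pow, ← RCLike.ofReal_intCast, RCLike.norm_ofReal]
  gcongr
  calc ‖x‖ ^ i ≤ c ^ i := by gcongr
    _ ≤ c ^ n := pow_le_pow_right₀ hc hi'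

theorem norm_pow_sub_pow_le {E : Type*} [RCLike E] {x y : E} {R : ℝ} (hR : 1 ≤ R)
    (hx : ‖x‖ ≤ R) (hy : ‖y‖ ≤ R) (i : ℕ) : ‖x ^ i - y ^ i‖ ≤ ‖x - y‖ * (i * R ^ i) := by
  induction i with
  | zero => simp
  | succ i ih =>
    have h : x ^ (i + 1) - y ^ (i + 1) = (x ^ i - y ^ i) * x + y ^ i * (x - y) := by ring
    rw [h]
    refine (norm_add_le _ _).trans ?_
    rw [norm_mul, norm_mul, norm_pow]
    have h1 : ‖x ^ i - y ^ i‖ * ‖x‖ ≤ (‖x - y‖ * (i * R ^ i)) * R := by gcongr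
    have h2 : ‖y‖ ^ i * ‖x - y‖ ≤ R ^ (i + 1) * ‖x - y‖ := by
      gcongr
      calc ‖y‖ ^ i ≤ R ^ i := by gcongr
        _ ≤ R ^ (i + 1) := pow_le_pow_right₀ hR i.le_succ
    push_cast
    calc _ ≤ _ := add_le_add h1 h2
      _ = _ := by ring

theorem norm_aeval_sub_le {E : Type*} [RCLike E] {x y : E} {R H : ℝ} (hR : 1 ≤ R)
    (hx : ‖x‖ ≤ R) (hy : ‖y‖ ≤ R) {P : ℤ[X]} {n : ℕ} (hP : P.natDegree ≤ n)
    (hH : ∀ i, ((P.coeff i).natAbs : ℝ) ≤ H) :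
    ‖aeval x P - aeval y P‖ ≤ ‖x - y‖ * ((n + 1) * (n * R ^ n)) * H := by
  rw [aeval_eq_sum_range' (Nat.lt_succ_of_le hP), aeval_eq_sum_range' (Nat.lt_succ_of_le hP),
    ← Finset.sum_sub_distrib]
  refine (norm_sum_le_of_le (n := fun _ => H * (‖x - y‖ * (n * R ^ n))) _ fun i hi => ?_).trans
    (le_of_eq (by simp; ring))
  have hi' := Nat.lt_succ_iff.mp (Finset.mem_range.mp hi)
  have h := hH i
  rw [Nat.cast_natAbs, Int.cast_abs] at h
  have hH0 : 0 ≤ H := (abs_nonneg _).trans h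
  rw [← smul_sub, zsmul_eq_mul, norm_mul, ← RCLike.ofReal_intCast, RCLike.norm_ofReal]
  gcongr
  refine (norm_pow_sub_pow_le hR hx hy i).trans ?_
  gcongr

omit [NumberField K] in
theorem norm_map_pow_mul_aeval {𝕜 : Type*} [RCLike 𝕜] (τ : K →+* 𝕜) (α : K) (T n : ℕ) (P : ℤ[X]) :
    ‖τ ((T : K) ^ n * aeval α P)‖ = T ^ n * ‖aeval (τ α) P‖ := by
  rw [map_mul, map_pow, map_natCast, norm_mul, norm_pow, RCLike.norm_natCast,
    ← RingHom.toIntAlgHom_apply τ, ← RingHom.toIntAlgHom_apply τ, aeval_algHom_apply]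

theorem one_le_norm_aeval_mul {𝕜 : Type*} [RCLike 𝕜] (σ : K →+* 𝕜) {α : K} {T : ℕ} (hT1 : 1 ≤ T)
    (hT : IsIntegral ℤ ((T : K) * α)) {c H : ℝ} (hc : 1 ≤ c) (hH1 : 1 ≤ H)
    (hα : ∀ τ : K →+* ℂ, ‖τ α‖ ≤ c) {P : ℤ[X]} {n : ℕ} (hP : P.natDegree ≤ n)
    (hH : ∀ i, ((P.coeff i).natAbs : ℝ) ≤ H) (h0 : aeval α P ≠ 0) :
    1 ≤ ‖aeval (σ α) P‖ * T ^ n * ((Module.finrank ℚ K + 1) * (2 ^ Module.finrank ℚ K *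
      (T ^ n * ((n + 1) * (H * c ^ n))) ^ Module.finrank ℚ K)) := by
  have hT0 : (T : K) ≠ 0 := by exact_mod_cast (by omega : T ≠ 0)
  have hT1' : (1 : ℝ) ≤ T := by exact_mod_cast hT1
  have h := one_le_norm_mul σ (isIntegral_pow_mul_aeval hT hP)
    (mul_ne_zero (pow_ne_zero _ hT0) h0) (B := T ^ n * ((n + 1) * (H * c ^ n))) ?_ ?_
  · rw [norm_map_pow_mul_aeval, mul_comm ((T : ℝ) ^ n) ‖aeval (σ α) P‖] at h
    exact h
  · have h1 : (1 : ℝ) ≤ n + 1 := by linarith [n.cast_nonneg (α := ℝ)]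
    exact one_le_mul_of_one_le_of_one_le (one_le_pow₀ hT1') (one_le_mul_of_one_le_of_one_le h1
      (one_le_mul_of_one_le_of_one_le hH1 (one_le_pow₀ hc)))
  · intro τ
    rw [norm_map_pow_mul_aeval]
    gcongr
    exact norm_aeval_le hc (hα τ) hP hH

/-- Substituting `T X` into the minimal polynomial of `T α` gives an integer polynomial killing `α`.
Full degree of `α` is what allows its coefficients to bound the height. -/
theorem height_le_of_isIntegral_mul {α : K} {T : ℕ} (hT1 : 1 ≤ T)
    (hT : IsIntegral ℤ ((T : K) * α)) {c : ℝ} (hc : 1 ≤ c) (hα : ∀ τ : K →+* ℂ, ‖τ α‖ ≤ c)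
    (hdeg : (minpoly ℚ α).natDegree = Module.finrank ℚ K) :
    (height α : ℝ) ≤ T ^ Module.finrank ℚ K * (2 ^ Module.finrank ℚ K *
      (T * c) ^ Module.finrank ℚ K) := by
  set m := Module.finrank ℚ K with hm
  have hT1' : (1 : ℝ) ≤ T := by exact_mod_cast hT1
  have halg : IsAlgebraic ℚ α := Algebra.IsAlgebraic.isAlgebraic α
  have hTZ : (T : ℤ) ≠ 0 := by exact_mod_cast (by omega : T ≠ 0)
  set Q := (minpoly ℤ ((T : K) * α)).comp (C (T : ℤ) * X) with hQ
  have hlin : (C (T : ℤ) * X).natDegree = 1 := natDegree_C_mul_X _ hTZ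
  have hQ0 : Q ≠ 0 := by
    rw [hQ, Ne, comp_eq_zero_iff, not_or]
    refine ⟨minpoly.ne_zero hT, fun h => ?_⟩
    have := congrArg natDegree h.2
    rw [hlin, natDegree_C] at this
    omega
  have hcoef : ∀ i, Q.coeff i = (minpoly ℤ ((T : K) * α)).coeff i * T ^ i := fun i => by
    rw [hQ, comp_C_mul_X_coeff]
  have hQd : Q.natDegree ≤ m := by
    rw [hQ, natDegree_comp, hlin, mul_one]
    exact natDegree_minpoly_le hT
  have hb := natAbs_coeff_minpoly_le hT (B := T * c)
    (one_le_mul_of_one_le_of_one_le hT1' hc) (fun τ => by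
      rw [map_mul, map_natCast, norm_mul, RCLike.norm_natCast]
      gcongr
      exact hα τ)
  rw [← hm] at hb
  refine (Nat.cast_le.mpr (height_le_of_aeval_eq_zero halg hQ0 (hQd.trans hdeg.ge) ?_
    (B := ⌊(T ^ m * (2 ^ m * (T * c) ^ m) : ℝ)⌋₊) fun i => ?_)).trans
    (Nat.floor_le (by positivity))
  · rw [hQ, aeval_comp]
    simp
  · rcases lt_or_ge m i with h | h
    · rw [coeff_eq_zero_of_natDegree_lt (hQd.trans_lt h)]
      simp
    · refine Nat.le_floor ?_
      rw [hcoef, Int.natAbs_mul, Int.natAbs_pow, Int.natAbs_natCast, Nat.cast_mul, Nat.cast_pow,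
        mul_comm]
      gcongr
      exact hb i

end NumberField

/-! ### A criterion for U-numbers. -/

section Criterion

theorem omegaStar_eq_top {𝕜 : Type*} [RCLike 𝕜] {n : ℕ} {z : 𝕜}
    (h : ∀ w : ℕ, 0 < w → (approximants n z w).Infinite) : omegaStar n z = ⊤ := by
  refine ENNReal.eq_top_of_forall_nnreal_le fun r => ?_
  obtain ⟨N, hN⟩ := exists_nat_ge r
  have h1 : ENNReal.ofReal ((N + 1 : ℕ) : ℝ) ≤ omegaStar n z :=
    le_iSup₂_of_le ((N + 1 : ℕ) : ℝ) ⟨by positivity, h (N + 1) N.succ_pos⟩ le_rfl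
  refine le_trans ?_ h1
  rw [ENNReal.ofReal_natCast]
  calc (r : ENNReal) ≤ (N : ENNReal) := by exact_mod_cast hN
    _ ≤ _ := by exact_mod_cast N.le_succ

/-- An exponent `w > N` would force `height β ≤ B` for every approximant, leaving only finitely
many. -/
theorem omegaStar_lt_top {𝕜 : Type*} [RCLike 𝕜] {n : ℕ} {z : 𝕜} {B : ℝ} {N : ℕ}
    (h : ∀ β : 𝕜, IsAlgebraic ℚ β → (minpoly ℚ β).natDegree = n →
      1 ≤ ‖z - β‖ * (B * (height β : ℝ) ^ N)) : omegaStar n z < ⊤ := by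
  refine lt_of_le_of_lt (iSup₂_le fun w hw => ?_) (ENNReal.natCast_lt_top N)
  rw [← ENNReal.ofReal_natCast]
  refine ENNReal.ofReal_le_ofReal ?_
  by_contra! hlt
  refine hw.2 ((finite_height_le n ⌈B⌉₊).subset ?_)
  rintro β ⟨halg, hd, hpos, hβ⟩
  refine ⟨halg, hd, ?_⟩
  have h1 := h β halg hd
  have hH : (1 : ℝ) ≤ height β := by exact_mod_cast one_le_height halg
  have hH0 : (0 : ℝ) < height β := by linarith
  have hBN : 0 < B * (height β : ℝ) ^ N := by
    by_contra! hle
    linarith [mul_nonpos_of_nonneg_of_nonpos hpos.le hle]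
  have hB : 0 < B := (pos_iff_pos_of_mul_pos hBN).mpr (by positivity)
  have h2 : (1 : ℝ) ≤ B * (height β : ℝ)⁻¹ := by
    calc 1 ≤ ‖z - β‖ * (B * (height β : ℝ) ^ N) := h1
      _ ≤ (height β : ℝ) ^ (-(N : ℝ) - 1) * (B * (height β : ℝ) ^ N) := by
          refine mul_le_mul_of_nonneg_right (hβ.le.trans ?_) hBN.le
          exact Real.rpow_le_rpow_of_exponent_le hH (by linarith)
      _ = B * (height β : ℝ)⁻¹ := by
          rw [Real.rpow_sub_one hH0.ne', Real.rpow_neg hH0.le, Real.rpow_natCast]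
          field_simp
  have h3 : (height β : ℝ) ≤ B := by
    rwa [← div_eq_mul_inv, le_div_iff₀ hH0, one_mul] at h2
  exact_mod_cast h3.trans (Nat.le_ceil B)

/-- If `q` grows faster than every power, then for every `X` there is an index at which `q k` is
polynomially bounded in `X` but `q (k + 1)` exceeds `X * q k ^ s`. -/
theorem exists_index_of_growth {q : ℕ → ℝ} (hq1 : ∀ k, 1 ≤ q k) (hq : Tendsto q atTop atTop)
    (hqw : ∀ w : ℕ, ∀ᶠ k in atTop, q k ^ w ≤ q (k + 1)) (s : ℕ) {p : ℕ → Prop}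
    (hp : ∀ᶠ k in atTop, p k) :
    ∃ Q : ℝ, 1 ≤ Q ∧ ∀ X : ℝ, 1 ≤ X → ∃ k, p k ∧ X * q k ^ s ≤ q (k + 1) ∧ q k ≤ Q * X ^ 2 := by
  classical
  obtain ⟨k₀, hk₀⟩ := eventually_atTop.mp (hp.and (hqw (2 * s)))
  refine ⟨q k₀, hq1 k₀, fun X hX => ?_⟩
  have hex : ∃ k, k₀ ≤ k ∧ X * q k ^ s ≤ q (k + 1) := by
    obtain ⟨k, h1, h2, h3⟩ := ((eventually_ge_atTop k₀).and
      ((hq.eventually_ge_atTop X).and (hqw (s + 1)))).exists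
    refine ⟨k, h1, le_trans ?_ h3⟩
    rw [pow_succ']
    have := hq1 k
    gcongr
  obtain ⟨h1, h2⟩ := Nat.find_spec hex
  refine ⟨Nat.find hex, (hk₀ _ h1).1, h2, ?_⟩
  have hX2 : 1 ≤ X ^ 2 := one_le_pow₀ hX
  rcases h1.eq_or_lt with h | h
  · rw [← h]
    exact le_mul_of_one_le_right (by linarith [hq1 k₀]) hX2
  obtain ⟨j, hj⟩ := Nat.exists_eq_succ_of_ne_zero (Nat.ne_zero_of_lt h)
  rw [Nat.succ_eq_add_one] at hj
  have hjk : k₀ ≤ j := by omega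
  -- Minimality gives q_{j+1} < X q_j^s. Squaring and using q_j^{2s} ≤ q_{j+1} yields q_{j+1} ≤ X².
  have h3 := Nat.find_min hex (m := j) (by omega)
  rw [not_and, not_le] at h3
  have h4 := h3 hjk
  have h5 := (hk₀ j hjk).2
  rw [hj]
  have hqj := hq1 (j + 1)
  have h6 : q (j + 1) ^ 2 ≤ X ^ 2 * q (j + 1) := by
    calc q (j + 1) ^ 2 ≤ (X * q j ^ s) ^ 2 := by gcongr
      _ = X ^ 2 * q j ^ (2 * s) := by ring
      _ ≤ X ^ 2 * q (j + 1) := by gcongr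
  have h7 : q (j + 1) ≤ X ^ 2 := by
    rw [sq (q (j + 1))] at h6
    exact le_of_mul_le_mul_right h6 (by linarith)
  exact h7.trans (le_mul_of_one_le_left (by positivity) (hq1 k₀))

variable {𝕜 : Type*} [RCLike 𝕜] {K : Type*} [Field K] [NumberField K]

/-- A Liouville inequality: elements of `K` of degree `[K : ℚ]` with controlled denominators and
conjugates are not close to algebraic numbers of smaller degree. -/
theorem one_le_norm_sub_mul (σ : K →+* 𝕜) {c R : ℝ} (hc : 1 ≤ c) (hR : 1 ≤ R) {n : ℕ}
    (hn : n < Module.finrank ℚ K) :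
    ∃ A : ℝ, 1 ≤ A ∧ ∃ M N : ℕ, ∀ (α : K) (T : ℕ) (β : 𝕜), 1 ≤ T → IsIntegral ℤ ((T : K) * α) →
      (∀ τ : K →+* ℂ, ‖τ α‖ ≤ c) → (minpoly ℚ α).natDegree = Module.finrank ℚ K →
      ‖σ α‖ ≤ R → ‖β‖ ≤ R → IsAlgebraic ℚ β → (minpoly ℚ β).natDegree = n →
      1 ≤ ‖σ α - β‖ * (A * (height β : ℝ) ^ M * (T : ℝ) ^ N) := by
  set m := Module.finrank ℚ K with hm
  set A : ℝ := ((n + 1) * (n * R ^ n)) * ((m + 1) * (2 ^ m * (((n : ℝ) + 1) * c ^ n) ^ m)) with hA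
  have hA0 : 0 ≤ A := by positivity
  -- The constant is `A + 1` because `A` vanishes for `n = 0`. One power of the height comes from
  -- the mean-value estimate, the other `m` from the conjugates.
  refine ⟨A + 1, by linarith, m + 1, n + n * m, fun α T β hT1 hT hα hdeg hσα hβR hβ hβn => ?_⟩
  have hH1 : (1 : ℝ) ≤ height β := by exact_mod_cast one_le_height hβ
  have hP : (intMinpoly β).natDegree ≤ n := by rw [natDegree_intMinpoly hβ, hβn]
  have hc' : ∀ i, (((intMinpoly β).coeff i).natAbs : ℝ) ≤ height β := fun i => by
    exact_mod_cast natAbs_coeff_intMinpoly_le β i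
  have h0 : aeval α (intMinpoly β) ≠ 0 := by
    intro h
    rw [← aeval_map_algebraMap ℚ] at h
    have h1 := natDegree_le_natDegree (minpoly.degree_le_of_ne_zero ℚ α
      ((Polynomial.map_ne_zero_iff (algebraMap ℤ ℚ).injective_int).mpr (intMinpoly_ne_zero hβ)) h)
    rw [hdeg, natDegree_map_eq_of_injective (algebraMap ℤ ℚ).injective_int] at h1
    omega
  have h1 := one_le_norm_aeval_mul σ hT1 hT hc hH1 hα hP hc' h0
  have h2 := norm_aeval_sub_le hR hσα hβR hP hc'
  rw [aeval_intMinpoly hβ, sub_zero] at h2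
  rw [← hm] at h1
  calc (1 : ℝ) ≤ _ := h1
    _ ≤ (‖σ α - β‖ * ((n + 1) * (n * R ^ n)) * height β) * T ^ n * ((m + 1) * (2 ^ m *
      (T ^ n * ((n + 1) * (height β * c ^ n))) ^ m)) := by gcongr
    _ = ‖σ α - β‖ * (A * (height β : ℝ) ^ (m + 1) * (T : ℝ) ^ (n + n * m)) := by
      rw [hA]
      simp only [mul_pow, pow_add, pow_mul]
      ring
    _ ≤ _ := by
      gcongr
      linarith

/-- A criterion for `z` to be a `U`-number: `z` is approximated by a sequence of elements of
degree `[K : ℚ]` of `K`, the denominators of which are bounded by powers of a sequence `q` growing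
faster than every power of itself. -/
theorem isUNumber_of_approx (σ : K →+* 𝕜) {z : 𝕜} {α : ℕ → K} {q : ℕ → ℝ} {T : ℕ → ℕ} {c : ℝ}
    {E : ℕ} (hc : 1 ≤ c) (hq1 : ∀ k, 1 ≤ q k) (hq : Tendsto q atTop atTop)
    (hqw : ∀ w : ℕ, ∀ᶠ k in atTop, q k ^ w ≤ q (k + 1))
    (hT1 : ∀ᶠ k in atTop, 1 ≤ T k) (hTint : ∀ᶠ k in atTop, IsIntegral ℤ ((T k : K) * α k))
    (hT : ∀ᶠ k in atTop, (T k : ℝ) ≤ c * q k ^ E)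
    (hτ : ∀ᶠ k in atTop, ∀ τ : K →+* ℂ, ‖τ (α k)‖ ≤ c)
    (hz : ∀ᶠ k in atTop, ‖z - σ (α k)‖ ≤ c / q (k + 1))
    (hdeg : ∀ᶠ k in atTop, (minpoly ℚ (α k)).natDegree = Module.finrank ℚ K)
    (hfin : ∀ x : K, {k | α k = x}.Finite) : IsUNumber (Module.finrank ℚ K) z := by
  set m := Module.finrank ℚ K with hm
  have hσinj : Function.Injective σ := σ.injective
  constructor
  · refine omegaStar_eq_top fun w hw => ?_
    -- Nothing here makes `z` transcendental, so equality is excluded through the finite fibres of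
    -- `α`.
    have hne : ∀ᶠ k in atTop, σ (α k) ≠ z := by
      by_cases hzr : ∃ x, σ x = z
      · obtain ⟨x, rfl⟩ := hzr
        have := (hfin x).compl_mem_cofinite
        rw [Nat.cofinite_eq_atTop] at this
        filter_upwards [this] with k hk h
        exact hk (hσinj h)
      · exact Eventually.of_forall fun k h => hzr ⟨_, h⟩
    set D : ℝ := c ^ m * (2 ^ m * (c * c) ^ m) with hD
    have hD1 : 1 ≤ D := one_le_mul_of_one_le_of_one_le (one_le_pow₀ hc)
      (one_le_mul_of_one_le_of_one_le (one_le_pow₀ one_le_two)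
        (one_le_pow₀ (one_le_mul_of_one_le_of_one_le hc hc)))
    -- The height is at most D q_k^{2Em}: `T` enters the height bound to the power `2 m`. The extra
    -- factor q_k in the growth condition absorbs c D^{w+1}.
    have hmem : ∀ᶠ k in atTop, σ (α k) ∈ approximants m z w := by
      filter_upwards [hne, hT1, hTint, hT, hτ, hz, hdeg,
        hq.eventually_gt_atTop (c * D ^ (w + 1)), hqw (1 + 2 * E * m * (w + 1))] with
        k hne hT1 hTint hT hτ hz hdeg hqD hqw
      have hqk := hq1 k
      have hqk' := hq1 (k + 1)
      have halg : IsAlgebraic ℚ (α k) := Algebra.IsAlgebraic.isAlgebraic _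
      have halg' : IsAlgebraic ℚ (σ (α k)) := halg.algHom σ.toRatAlgHom
      have hh : height (σ (α k)) = height (α k) := height_algHom σ.toRatAlgHom (α k)
      refine ⟨halg', ?_, norm_pos_iff.mpr (sub_ne_zero.mpr hne.symm), hz.trans_lt ?_⟩
      · rw [← hdeg, ← minpoly.algHom_eq σ.toRatAlgHom hσinj (α k)]
        rfl
      have hH1 : (1 : ℝ) ≤ height (σ (α k)) := by exact_mod_cast one_le_height halg'
      have hHD : (height (σ (α k)) : ℝ) ≤ D * q k ^ (2 * E * m) := by
        rw [hh]
        calc _ ≤ (T k : ℝ) ^ m * (2 ^ m * (T k * c) ^ m) :=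
              height_le_of_isIntegral_mul hT1 hTint hc hτ hdeg
          _ ≤ (c * q k ^ E) ^ m * (2 ^ m * ((c * q k ^ E) * c) ^ m) := by gcongr
          _ = _ := by rw [hD]; simp only [mul_pow, ← pow_mul]; ring
      have hrw : (height (σ (α k)) : ℝ) ^ (-(w : ℝ) - 1) =
          ((height (σ (α k)) : ℝ) ^ (w + 1))⁻¹ := by
        rw [← Real.rpow_natCast, ← Real.rpow_neg (by linarith)]
        congr 1
        push_cast
        ring
      rw [hrw, div_lt_iff₀ (by linarith), inv_mul_eq_div, lt_div_iff₀ (by positivity)]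
      calc c * (height (σ (α k)) : ℝ) ^ (w + 1) ≤ c * (D * q k ^ (2 * E * m)) ^ (w + 1) := by
            gcongr
        _ = (c * D ^ (w + 1)) * q k ^ (2 * E * m * (w + 1)) := by rw [mul_pow, ← pow_mul]; ring
        _ < q k * q k ^ (2 * E * m * (w + 1)) := by gcongr
        _ = q k ^ (1 + 2 * E * m * (w + 1)) := by ring
        _ ≤ q (k + 1) := hqw
    intro hfinite
    obtain ⟨k₀, hk₀⟩ := eventually_atTop.mp hmem
    refine (Set.Ici_infinite k₀) ((Set.Finite.preimage' hfinite fun b _ => ?_).subset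
      (fun k hk => hk₀ k hk))
    by_cases hb : ∃ x, σ x = b
    · obtain ⟨x, rfl⟩ := hb
      exact (hfin x).subset fun k hk => hσinj hk
    · exact Set.Finite.subset Set.finite_empty fun k hk => hb ⟨_, hk⟩
  · intro n _ hnm
    have hR : 1 ≤ ‖z‖ + c + 1 := by linarith [norm_nonneg z]
    obtain ⟨A, hA1, M, N, hA⟩ := one_le_norm_sub_mul σ hc hR hnm
    obtain ⟨Q, hQ1, hQ⟩ := exists_index_of_growth hq1 hq hqw (E * N)
      (hT1.and (hTint.and (hT.and (hτ.and (hz.and hdeg)))))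
    -- Chosen so that X₀ H(β)^M q_k^{EN} = 2cY below: the error ‖z - σ α_k‖ is then at most half of
    -- the lower bound 1/Y for ‖σ α_k - β‖.
    set X₀ : ℝ := 2 * c * A * c ^ N with hX₀
    have hX₀1 : 1 ≤ X₀ := one_le_mul_of_one_le_of_one_le (one_le_mul_of_one_le_of_one_le
      (one_le_mul_of_one_le_of_one_le one_le_two hc) hA1) (one_le_pow₀ hc)
    have hB1 : (1 : ℝ) ≤ 2 * A * c ^ N * (Q * X₀ ^ 2) ^ (E * N) :=
      one_le_mul_of_one_le_of_one_le (one_le_mul_of_one_le_of_one_le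
        (one_le_mul_of_one_le_of_one_le one_le_two hA1) (one_le_pow₀ hc))
        (one_le_pow₀ (one_le_mul_of_one_le_of_one_le hQ1 (one_le_pow₀ hX₀1)))
    refine omegaStar_lt_top (B := 2 * A * c ^ N * (Q * X₀ ^ 2) ^ (E * N))
      (N := M + 2 * M * (E * N)) fun β hβ hβn => ?_
    have hH1 : (1 : ℝ) ≤ height β := by exact_mod_cast one_le_height hβ
    rcases le_or_gt 1 ‖z - β‖ with h1 | h1
    · exact one_le_mul_of_one_le_of_one_le h1 (one_le_mul_of_one_le_of_one_le hB1 (one_le_pow₀ hH1))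
    obtain ⟨k, ⟨hT1, hTint, hT, hτ, hz, hdeg⟩, hX, hqQ⟩ := hQ (X₀ * height β ^ M)
      (one_le_mul_of_one_le_of_one_le hX₀1 (one_le_pow₀ hH1))
    have hqk := hq1 k
    have hqk' := hq1 (k + 1)
    have hσR : ‖σ (α k)‖ ≤ ‖z‖ + c + 1 := by
      have h2 : ‖σ (α k)‖ ≤ ‖z‖ + ‖z - σ (α k)‖ := by
        rw [norm_sub_rev]; exact norm_le_norm_add_norm_sub' _ _
      have h3 : c / q (k + 1) ≤ c := div_le_self (by linarith) hqk'
      linarith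
    have hβR : ‖β‖ ≤ ‖z‖ + c + 1 := by
      have h2 : ‖β‖ ≤ ‖z‖ + ‖z - β‖ := by
        rw [norm_sub_rev]; exact norm_le_norm_add_norm_sub' _ _
      linarith
    have h4 := hA (α k) (T k) β hT1 hTint hτ hdeg hσR hβR hβ hβn
    set Y : ℝ := A * (height β : ℝ) ^ M * (c * q k ^ E) ^ N with hY
    have hY0 : 0 < Y := by positivity
    have h5 : 1 ≤ ‖σ (α k) - β‖ * Y := by
      refine h4.trans ?_
      rw [hY]
      gcongr
    have h6 : ‖z - σ (α k)‖ * Y ≤ 1 / 2 := by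
      calc ‖z - σ (α k)‖ * Y ≤ c / q (k + 1) * Y := by gcongr
        _ = c * Y / q (k + 1) := by ring
        _ ≤ 1 / 2 := by
          rw [div_le_iff₀ (by linarith)]
          have : X₀ * (height β : ℝ) ^ M * q k ^ (E * N) = 2 * (c * Y) := by
            rw [hX₀, hY, mul_pow, ← pow_mul]; ring
          linarith
    have h7 : ‖σ (α k) - β‖ ≤ ‖z - σ (α k)‖ + ‖z - β‖ := by
      rw [norm_sub_rev z (σ (α k))]
      exact norm_sub_le_norm_sub_add_norm_sub _ _ _
    have h8 : 1 ≤ ‖z - β‖ * (2 * Y) := by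
      have := mul_le_mul_of_nonneg_right h7 hY0.le
      linarith
    refine h8.trans (mul_le_mul_of_nonneg_left ?_ (norm_nonneg _))
    calc 2 * Y = 2 * A * c ^ N * (height β : ℝ) ^ M * q k ^ (E * N) := by
          rw [hY, mul_pow, ← pow_mul]; ring
      _ ≤ 2 * A * c ^ N * (height β : ℝ) ^ M * (Q * (X₀ * height β ^ M) ^ 2) ^ (E * N) := by gcongr
      _ = 2 * A * c ^ N * (height β : ℝ) ^ M *
          ((Q * X₀ ^ 2) * (height β : ℝ) ^ (2 * M)) ^ (E * N) := by
          congr 2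
          ring
      _ = _ := by
          rw [mul_pow (Q * X₀ ^ 2), ← pow_mul, pow_add (height β : ℝ)]
          ring

end Criterion

/-! ### Values of a rational function at rational points. -/

section RationalFunction

/-- Needed for a linear projection onto a subfield, which is additive but not multiplicative. -/
theorem exists_coeff_eq_map {R : Type*} [CommRing R] (p : R[X]) (ψ : R →+ R) :
    ∃ p' : R[X], (∀ i, p'.coeff i = ψ (p.coeff i)) ∧ p'.natDegree ≤ p.natDegree := by
  have h : ∀ i, (∑ j ∈ Finset.range (p.natDegree + 1), monomial j (ψ (p.coeff j))).coeff i =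
      ψ (p.coeff i) := by
    intro i
    simp only [finsetSum_coeff, coeff_monomial, Finset.sum_ite_eq', Finset.mem_range]
    split_ifs with hi
    · rfl
    · rw [coeff_eq_zero_of_natDegree_lt (by omega), map_zero]
  refine ⟨_, h, natDegree_le_iff_coeff_eq_zero.mpr fun i hi => ?_⟩
  rw [h, coeff_eq_zero_of_natDegree_lt hi, map_zero]

variable {K : Type*} [Field K]

theorem finite_eval_ratCast_eq_zero [CharZero K] {p : K[X]} (hp : p ≠ 0) :
    {r : ℚ | p.eval (r : K) = 0}.Finite := by
  classical
  refine Set.Finite.of_finite_image ((p.roots.toFinset.finite_toSet).subset ?_)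
    (Rat.cast_injective (α := K)).injOn
  rintro _ ⟨r, hr, rfl⟩
  simpa [hp] using hr

/-- The value at `x` of a rational function. -/
def value (F : RatFunc K) (x : K) : K := F.num.eval x / F.denom.eval x

theorem finite_value_eq [CharZero K] {F : RatFunc K} (hF : ∀ c : K, F ≠ RatFunc.C c) (x : K) :
    {r : ℚ | F.denom.eval (r : K) ≠ 0 ∧ value F r = x}.Finite := by
  have h : F.num - C x * F.denom ≠ 0 := by
    intro h
    refine hF x ?_
    have hd : algebraMap K[X] (RatFunc K) F.denom ≠ 0 :=
      RatFunc.algebraMap_ne_zero F.denom_ne_zero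
    rw [← F.num_div_denom, sub_eq_zero.mp h, map_mul, mul_div_cancel_right₀ _ hd,
      RatFunc.algebraMap_C]
  refine (finite_eval_ratCast_eq_zero h).subset fun r hr => ?_
  have h1 := hr.2
  rw [value, div_eq_iff hr.1] at h1
  simp [h1]

/-- Apply an `L`-linear retraction `ψ` of `K` onto `L` to the coefficients of numerator and
denominator, getting `A` and `B`. Where F(r) ∈ L, linearity gives A(r) = F(r) B(r), so `F.num * B =
F.denom * A` holds at infinitely many points and hence identically. Since ψ(1) = 1, `B` is monic of
the same degree as `F.denom`, and coprimality gives `B = F.denom`, `A = F.num`. All coefficients are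
thus values of `ψ`. -/
theorem coeffField_le_of_infinite [CharZero K] {F : RatFunc K} {L : IntermediateField ℚ K}
    (h : {r : ℚ | F.denom.eval (r : K) ≠ 0 ∧ value F r ∈ L}.Infinite) : coeffField F ≤ L := by
  obtain ⟨φ, hφ⟩ := LinearMap.exists_leftInverse_of_injective (Algebra.linearMap L K)
    (LinearMap.ker_eq_bot.mpr (algebraMap L K).injective)
  set ψ : K →ₗ[L] K := (Algebra.linearMap L K).comp φ with hψ
  have hψL : ∀ x, ψ x ∈ L := fun x => (φ x).2
  have hψ1 : ψ 1 = 1 := by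
    have := LinearMap.congr_fun hφ 1
    simp only [LinearMap.comp_apply, LinearMap.id_apply, Algebra.linearMap_apply, map_one] at this
    simp [hψ, this]
  have hψmul : ∀ (l x : K), l ∈ L → ψ (l * x) = l * ψ x := fun l x hl => by
    have := ψ.map_smul ⟨l, hl⟩ x
    simpa [IntermediateField.smul_def] using this
  have heval : ∀ {p p' : K[X]}, (∀ i, p'.coeff i = ψ (p.coeff i)) →
      p'.natDegree ≤ p.natDegree → ∀ r : ℚ, p'.eval (r : K) = ψ (p.eval (r : K)) := by
    intro p p' hp hd r
    rw [eval_eq_sum_range' (Nat.lt_succ_of_le hd), eval_eq_sum_range, map_sum]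
    refine Finset.sum_congr rfl fun i _ => ?_
    have hrL : (r : K) ^ i ∈ L := pow_mem (by simp) i
    rw [hp, mul_comm, ← hψmul _ _ hrL, mul_comm]
  obtain ⟨A, hA, hAd⟩ := exists_coeff_eq_map F.num ψ.toAddMonoidHom
  obtain ⟨B, hB, hBd⟩ := exists_coeff_eq_map F.denom ψ.toAddMonoidHom
  have hmonic := F.monic_denom
  have hBmonic : B.Monic := by
    refine monic_of_natDegree_le_of_coeff_eq_one _ hBd ?_
    rw [hB, hmonic.coeff_natDegree]
    exact hψ1
  have hprod : F.num * B = F.denom * A := by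
    rw [← sub_eq_zero]
    by_contra hne
    refine h ((finite_eval_ratCast_eq_zero hne).subset fun r hr => ?_)
    obtain ⟨hr0, hrL⟩ := hr
    have h1 : F.num.eval (r : K) = value F r * F.denom.eval (r : K) := by
      rw [value, div_mul_cancel₀ _ hr0]
    have h2 : A.eval (r : K) = value F r * B.eval (r : K) := by
      rw [heval hA hAd, heval hB hBd, h1, hψmul _ _ hrL]
    simp only [Set.mem_ofPred_eq, eval_sub, eval_mul, h1, h2]
    ring
  have hdvd : F.denom ∣ B :=
    F.isCoprime_num_denom.symm.dvd_of_dvd_mul_left ⟨A, hprod⟩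
  have hBeq : B = F.denom :=
    eq_of_monic_of_dvd_of_natDegree_le hmonic hBmonic hdvd hBd
  have hAeq : A = F.num := by
    rw [hBeq, mul_comm] at hprod
    exact (mul_left_cancel₀ F.denom_ne_zero hprod).symm
  rw [coeffField, IntermediateField.adjoin_le_iff]
  rintro x (hx | hx)
  · obtain ⟨i, -, rfl⟩ := mem_coeffs_iff.mp hx
    rw [← hAeq, hA]
    exact hψL _
  · obtain ⟨i, -, rfl⟩ := mem_coeffs_iff.mp hx
    rw [← hBeq, hB]
    exact hψL _

/-- A value of smaller degree generates a proper subfield, and `K` has only finitely many of these.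
-/
theorem finite_natDegree_minpoly_ne [NumberField K] {F : RatFunc K} (hF : coeffField F = ⊤) :
    {r : ℚ | F.denom.eval (r : K) ≠ 0 ∧
      (minpoly ℚ (value F r)).natDegree ≠ Module.finrank ℚ K}.Finite := by
  have hfin : Finite (IntermediateField ℚ K) :=
    Field.finite_intermediateField_of_exists_primitive_element ℚ K
      (Field.exists_primitive_element ℚ K)
  have : (⋃ L : {L : IntermediateField ℚ K // L ≠ ⊤},
      {r : ℚ | F.denom.eval (r : K) ≠ 0 ∧ value F r ∈ L.1}).Finite := by
    refine Set.finite_iUnion fun L => ?_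
    by_contra hinf
    exact L.2 (top_le_iff.mp (hF.symm.trans_le (coeffField_le_of_infinite hinf)))
  refine this.subset fun r hr => ?_
  rw [Set.mem_iUnion]
  refine ⟨⟨IntermediateField.adjoin ℚ {value F (r : K)}, fun h => hr.2 ?_⟩, hr.1,
    IntermediateField.mem_adjoin_simple_self ℚ _⟩
  rwa [← Field.primitive_element_iff_minpoly_natDegree_eq]

theorem isIntegral_natCast' (n : ℕ) : IsIntegral ℤ (n : K) := by
  simpa using isIntegral_algebraMap (R := ℤ) (A := K) (x := n)

theorem exists_common_integral_multiple [NumberField K] (s : Finset K) :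
    ∃ D : ℕ, 1 ≤ D ∧ ∀ x ∈ s, IsIntegral ℤ ((D : K) * x) := by
  classical
  induction s using Finset.induction_on with
  | empty => exact ⟨1, le_rfl, by simp⟩
  | insert x s _ ih =>
    obtain ⟨D, hD, h⟩ := ih
    have hx : IsAlgebraic ℤ x :=
      (IsFractionRing.isAlgebraic_iff ℤ ℚ K).mpr (Algebra.IsAlgebraic.isAlgebraic x)
    obtain ⟨y, hy, hyx⟩ := hx.exists_integral_multiple
    have hyx' : IsIntegral ℤ ((y.natAbs : K) * x) := by
      rw [zsmul_eq_mul] at hyx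
      rcases Int.natAbs_eq y with h1 | h1
      · rw [h1] at hyx
        simpa using hyx
      · rw [h1] at hyx
        simpa using hyx.neg
    refine ⟨y.natAbs * D, Nat.mul_pos (Int.natAbs_pos.mpr hy) hD, fun w hw => ?_⟩
    rcases Finset.mem_insert.mp hw with rfl | hw
    · rw [mul_comm y.natAbs, Nat.cast_mul, mul_assoc]
      exact (isIntegral_natCast' D).mul hyx'
    · rw [Nat.cast_mul, mul_assoc]
      exact (isIntegral_natCast' _).mul (h w hw)

theorem isIntegral_mul_eval [CharZero K] {p : K[X]} {D d : ℕ}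
    (hD : ∀ x ∈ p.coeffs, IsIntegral ℤ ((D : K) * x)) (hd : p.natDegree ≤ d) {r : ℚ} {q : ℕ}
    {a : ℤ} (hq : 1 ≤ q) (hr : r = a / q) :
    IsIntegral ℤ ((D : K) * (q : K) ^ d * p.eval (r : K)) := by
  have hq0 : (q : K) ≠ 0 := by exact_mod_cast (by omega : q ≠ 0)
  rw [eval_eq_sum_range' (Nat.lt_succ_of_le hd), Finset.mul_sum]
  refine IsIntegral.sum _ fun i hi => ?_
  obtain ⟨j, rfl⟩ := Nat.exists_eq_add_of_le (Nat.lt_succ_iff.mp (Finset.mem_range.mp hi))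
  have h1 : (D : K) * (q : K) ^ (i + j) * (p.coeff i * (r : K) ^ i) =
      ((D : K) * p.coeff i) * algebraMap ℤ K (q ^ j * a ^ i) := by
    rw [hr, algebraMap_int_eq, eq_intCast, Rat.cast_div, Rat.cast_intCast, Rat.cast_natCast,
      div_pow, pow_add]
    push_cast
    field_simp
  rw [h1]
  refine IsIntegral.mul ?_ isIntegral_algebraMap
  by_cases h0 : p.coeff i = 0
  · rw [h0, mul_zero]
    exact isIntegral_zero
  · exact hD _ (coeff_mem_coeffs h0)

theorem exists_norm_eval_le [NumberField K] (p : K[X]) (R : ℝ) :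
    ∃ B : ℝ, 1 ≤ B ∧ ∀ (r : ℚ) (τ : K →+* ℂ), |(r : ℝ)| ≤ R → ‖τ (p.eval (r : K))‖ ≤ B := by
  refine ⟨1 + ∑ τ : K →+* ℂ, ∑ i ∈ Finset.range (p.natDegree + 1), ‖τ (p.coeff i)‖ * |R| ^ i,
    le_add_of_nonneg_right (by positivity), fun r τ hr => ?_⟩
  refine le_trans ?_ (le_add_of_nonneg_left zero_le_one)
  refine le_trans ?_ (Finset.single_le_sum (f := fun τ : K →+* ℂ =>
    ∑ i ∈ Finset.range (p.natDegree + 1), ‖τ (p.coeff i)‖ * |R| ^ i)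
    (fun τ _ => by positivity) (Finset.mem_univ τ))
  rw [eval_eq_sum_range, map_sum]
  refine norm_sum_le_of_le _ fun i _ => ?_
  rw [map_mul, map_pow, map_ratCast, norm_mul, norm_pow]
  have : ‖(r : ℂ)‖ = |(r : ℝ)| := by
    rw [← Complex.ofReal_ratCast, Complex.norm_real, Real.norm_eq_abs]
  rw [this]
  exact mul_le_mul_of_nonneg_left
    (pow_le_pow_left₀ (abs_nonneg _) (hr.trans (le_abs_self R)) i) (norm_nonneg _)

/-- Let `D` clear the coefficients of `F`. Then D q^d times numerator and denominator at `r` are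
integral, and `exists_nat_multiple` replaces the integral denominator by a natural number. -/
theorem exists_denominator_bound [NumberField K] (F : RatFunc K) (R : ℝ) :
    ∃ c : ℝ, 1 ≤ c ∧ ∃ E : ℕ, ∀ (r : ℚ) (q : ℕ) (a : ℤ), 1 ≤ q → r = a / q → |(r : ℝ)| ≤ R →
      F.denom.eval (r : K) ≠ 0 →
      ∃ T : ℕ, 1 ≤ T ∧ IsIntegral ℤ ((T : K) * value F r) ∧ (T : ℝ) ≤ c * (q : ℝ) ^ E := by
  classical
  obtain ⟨D, hD1, hD⟩ := exists_common_integral_multiple (F.num.coeffs ∪ F.denom.coeffs)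
  obtain ⟨B, hB1, hB⟩ := exists_norm_eval_le F.denom R
  set d := max F.num.natDegree F.denom.natDegree
  set m := Module.finrank ℚ K with hm
  have hD1' : (1 : ℝ) ≤ D := by exact_mod_cast hD1
  refine ⟨2 ^ m * (D * B) ^ m, one_le_mul_of_one_le_of_one_le (one_le_pow₀ one_le_two)
    (one_le_pow₀ (one_le_mul_of_one_le_of_one_le hD1' hB1)), d * m,
    fun r q a hq hr hrR h0 => ?_⟩
  have hq1 : (1 : ℝ) ≤ q := by exact_mod_cast hq
  have hq0 : (q : K) ≠ 0 := by exact_mod_cast (by omega : q ≠ 0)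
  have hD0 : (D : K) ≠ 0 := by exact_mod_cast (by omega : D ≠ 0)
  have hnum := isIntegral_mul_eval (fun x hx => hD x (Finset.mem_union_left _ hx))
    (le_max_left _ _ : F.num.natDegree ≤ d) hq hr
  have hden := isIntegral_mul_eval (fun x hx => hD x (Finset.mem_union_right _ hx))
    (le_max_right _ _ : F.denom.natDegree ≤ d) hq hr
  obtain ⟨T, hT1, hT, hTint⟩ := exists_nat_multiple hden
    (mul_ne_zero (mul_ne_zero hD0 (pow_ne_zero _ hq0)) h0) (B := D * q ^ d * B)
    (one_le_mul_of_one_le_of_one_le (one_le_mul_of_one_le_of_one_le hD1' (one_le_pow₀ hq1)) hB1)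
    (fun τ => by
      rw [map_mul, map_mul, map_pow, map_natCast, map_natCast, norm_mul, norm_mul, norm_pow,
        RCLike.norm_natCast, RCLike.norm_natCast]
      gcongr
      exact hB r τ hrR)
  refine ⟨T, hT1, ?_, hT.trans (le_of_eq ?_)⟩
  · have : (T : K) * value F r = ((T : K) / ((D : K) * (q : K) ^ d * F.denom.eval (r : K))) *
        ((D : K) * (q : K) ^ d * F.num.eval (r : K)) := by
      rw [value]
      field_simp
    rw [this]
    exact hTint.mul hnum
  · rw [← hm, pow_mul, mul_pow, mul_pow, mul_pow]
    ring

theorem eval₂_ne_zero_of_transcendental [NumberField K] {𝕜 : Type*} [RCLike 𝕜] (σ : K →+* 𝕜)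
    {ξ : ℝ} (hξ : Transcendental ℤ ξ) {p : K[X]} (hp : p ≠ 0) : p.eval₂ σ (ξ : 𝕜) ≠ 0 := by
  intro h
  let : Algebra K 𝕜 := σ.toAlgebra
  have h1 : IsAlgebraic K (ξ : 𝕜) := ⟨p, hp, h⟩
  have h2 : IsAlgebraic ℚ (ξ : 𝕜) := h1.restrictScalars ℚ
  have h3 : IsAlgebraic ℤ (ξ : 𝕜) := (IsFractionRing.isAlgebraic_iff ℤ ℚ 𝕜).mpr h2
  refine hξ ((isAlgebraic_algebraMap_iff (A := 𝕜) (algebraMap ℝ 𝕜).injective).mp ?_)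
  exact h3

theorem map_value_ratCast [CharZero K] {𝕜 : Type*} [RCLike 𝕜] (σ : K →+* 𝕜) (F : RatFunc K)
    (r : ℚ) : σ (value F r) =
      F.num.eval₂ σ ((r : ℝ) : 𝕜) / F.denom.eval₂ σ ((r : ℝ) : 𝕜) := by
  rw [value, map_div₀, ← eval₂_at_apply, ← eval₂_at_apply, map_ratCast, RCLike.ofReal_ratCast]

theorem differentiableAt_eval₂_div {𝕜 : Type*} [RCLike 𝕜] (σ : K →+* 𝕜) (F : RatFunc K)
    {x : 𝕜} (hx : F.denom.eval₂ σ x ≠ 0) :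
    DifferentiableAt 𝕜 (fun y => F.num.eval₂ σ y / F.denom.eval₂ σ y) x := by
  simp only [← eval_map] at hx ⊢
  exact (Polynomial.differentiableAt _).div (Polynomial.differentiableAt _) hx

theorem isUNumber_eval₂_div [NumberField K] {𝕜 : Type*} [RCLike 𝕜] (σ : K →+* 𝕜)
    {F : RatFunc K} (hF : ∀ c : K, F ≠ RatFunc.C c) (hFK : coeffField F = ⊤) {ξ : ℝ}
    (hξ : Transcendental ℤ ξ) {r : ℕ → ℚ} (hinj : Function.Injective r) {q : ℕ → ℕ}
    (hq1 : ∀ k, 1 ≤ q k) (hq : Tendsto (fun k => (q k : ℝ)) atTop atTop)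
    (hqw : ∀ w : ℕ, ∀ᶠ k in atTop, (q k : ℝ) ^ w ≤ q (k + 1))
    (hr : ∀ k, ∃ a : ℤ, r k = a / q k) {c : ℝ} (hξr : ∀ k, |ξ - r k| ≤ c / q (k + 1)) :
    IsUNumber (Module.finrank ℚ K) (F.num.eval₂ σ (ξ : 𝕜) / F.denom.eval₂ σ (ξ : 𝕜)) := by
  have hcof : ∀ {s : Set ℚ}, s.Finite → ∀ᶠ k in atTop, r k ∉ s := fun {s} hs => by
    rw [← Nat.cofinite_eq_atTop]
    exact (hs.preimage hinj.injOn).compl_mem_cofinite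
  have hlim : Tendsto (fun k => (r k : ℝ)) atTop (𝓝 ξ) := by
    rw [tendsto_iff_norm_sub_tendsto_zero]
    have h0 : Tendsto (fun k => c / (q (k + 1) : ℝ)) atTop (𝓝 0) :=
      Tendsto.div_atTop tendsto_const_nhds (hq.comp (tendsto_add_atTop_nat 1))
    refine squeeze_zero (fun _ => norm_nonneg _) (fun k => ?_) h0
    rw [norm_sub_rev]
    exact hξr k
  have hlim' : Tendsto (fun k => ((r k : ℝ) : 𝕜)) atTop (𝓝 (ξ : 𝕜)) :=
    (RCLike.continuous_ofReal.tendsto ξ).comp hlim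
  have hlimC : Tendsto (fun k => ((r k : ℝ) : ℂ)) atTop (𝓝 (ξ : ℂ)) :=
    (RCLike.continuous_ofReal.tendsto ξ).comp hlim
  have hden : ∀ᶠ k in atTop, F.denom.eval (r k : K) ≠ 0 :=
    hcof (finite_eval_ratCast_eq_zero F.denom_ne_zero)
  have hbound : ∀ᶠ k in atTop, |(r k : ℝ)| ≤ |ξ| + 1 :=
    (hlim.abs.eventually_lt_const (lt_add_one _)).mono fun _ h => h.le
  obtain ⟨c₁, hc₁, E, hE⟩ := exists_denominator_bound F (|ξ| + 1)
  have hT : ∀ k, ∃ T : ℕ, F.denom.eval (r k : K) ≠ 0 → |(r k : ℝ)| ≤ |ξ| + 1 →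
      1 ≤ T ∧ IsIntegral ℤ ((T : K) * value F (r k)) ∧ (T : ℝ) ≤ c₁ * (q k : ℝ) ^ E := by
    intro k
    by_cases h : F.denom.eval (r k : K) ≠ 0 ∧ |(r k : ℝ)| ≤ |ξ| + 1
    · obtain ⟨a, ha⟩ := hr k
      obtain ⟨T, h1⟩ := hE (r k) (q k) a (hq1 k) ha h.2 h.1
      exact ⟨T, fun _ _ => h1⟩
    · exact ⟨0, fun h1 h2 => absurd ⟨h1, h2⟩ h⟩
  choose T hT using hT
  set G : (K →+* ℂ) → ℂ := fun τ => F.num.eval₂ τ ((ξ : ℝ) : ℂ) / F.denom.eval₂ τ ((ξ : ℝ) : ℂ)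
    with hG
  have hconj : ∀ᶠ k in atTop, ∀ τ : K →+* ℂ, ‖τ (value F (r k))‖ ≤ ∑ τ, (‖G τ‖ + 1) := by
    rw [eventually_all]
    intro τ
    have hd := (differentiableAt_eval₂_div τ F
      (eval₂_ne_zero_of_transcendental τ hξ F.denom_ne_zero)).continuousAt
    have h1 := (hd.tendsto.comp hlimC).norm.eventually_lt_const (lt_add_one _)
    filter_upwards [h1] with k hk
    rw [map_value_ratCast]
    refine le_trans hk.le (Finset.single_le_sum (f := fun τ => ‖G τ‖ + 1)
      (fun τ _ => by positivity) (Finset.mem_univ τ))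
  have hd := (differentiableAt_eval₂_div σ F
    (eval₂_ne_zero_of_transcendental σ hξ F.denom_ne_zero)).isBigO_sub
  obtain ⟨c₂, hc₂, hO⟩ := (hd.comp_tendsto hlim').exists_pos
  have hz := hO.bound
  -- The finite-fibre hypothesis of the criterion concerns every index, while poles are avoided only
  -- eventually; shifting by `k₀` removes them.
  obtain ⟨k₀, hk₀⟩ := eventually_atTop.mp hden
  set c' : ℝ := max (max 1 c₁) (max (∑ τ, (‖G τ‖ + 1)) (c₂ * c)) with hc'
  have h1' : 1 ≤ c' := (le_max_left _ _).trans (le_max_left _ _)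
  have h2' : c₁ ≤ c' := (le_max_right _ _).trans (le_max_left _ _)
  have h3' : ∑ τ, (‖G τ‖ + 1) ≤ c' := (le_max_left _ _).trans (le_max_right _ _)
  have h4' : c₂ * c ≤ c' := (le_max_right _ _).trans (le_max_right _ _)
  have hshift : Tendsto (fun k => k + k₀) atTop atTop := tendsto_add_atTop_nat k₀
  refine isUNumber_of_approx σ (α := fun k => value F (r (k + k₀)))
    (q := fun k => (q (k + k₀) : ℝ)) (T := fun k => T (k + k₀)) (c := c') (E := E) h1'
    (fun k => by exact_mod_cast hq1 _) (hq.comp hshift) (fun w => ?_) ?_ ?_ ?_ ?_ ?_ ?_ ?_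
  · filter_upwards [hshift.eventually (hqw w)] with k hk
    rwa [add_right_comm]
  · filter_upwards [hshift.eventually (hden.and hbound)] with k hk
    exact (hT _ hk.1 hk.2).1
  · filter_upwards [hshift.eventually (hden.and hbound)] with k hk
    exact (hT _ hk.1 hk.2).2.1
  · filter_upwards [hshift.eventually (hden.and hbound)] with k hk
    refine (hT _ hk.1 hk.2).2.2.trans ?_
    gcongr
  · filter_upwards [hshift.eventually hconj] with k hk τ
    exact (hk τ).trans h3'
  · filter_upwards [hshift.eventually hz] with k hk
    rw [map_value_ratCast, norm_sub_rev]
    refine hk.trans ?_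
    have h5 : ‖((r (k + k₀) : ℝ) : 𝕜) - (ξ : 𝕜)‖ = |ξ - r (k + k₀)| := by
      rw [← RCLike.ofReal_sub, RCLike.norm_ofReal, abs_sub_comm]
    simp only [Function.comp_apply]
    rw [h5, add_right_comm k 1 k₀]
    calc c₂ * |ξ - r (k + k₀)| ≤ c₂ * (c / q (k + k₀ + 1)) := by
          gcongr
          exact hξr _
      _ = c₂ * c / q (k + k₀ + 1) := by ring
      _ ≤ _ := by gcongr
  · filter_upwards [hshift.eventually (hden.and (hcof (finite_natDegree_minpoly_ne hFK)))]
      with k hk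
    by_contra h
    exact hk.2 ⟨hk.1, h⟩
  · intro x
    refine ((finite_value_eq hF x).preimage
      (f := fun k => r (k + k₀)) (hinj.comp (add_left_injective k₀)).injOn).subset fun k hk => ?_
    exact ⟨hk₀ _ (Nat.le_add_left _ _), hk⟩

end RationalFunction

/-! ### Lacunary series and the class 𝓛. -/

section Series

theorem height_ratCast_le {r : ℚ} {p : ℤ} {q B : ℕ} (hq : 1 ≤ q) (hr : r = p / q)
    (hqB : q ≤ B) (hpB : p.natAbs ≤ B) : height r ≤ B := by
  have hq0 : (q : ℤ) ≠ 0 := by exact_mod_cast (by omega : q ≠ 0)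
  have hlin : (C (q : ℤ) * X + C (-p)).natDegree = 1 := natDegree_linear hq0
  refine height_le_of_aeval_eq_zero (Q := C (q : ℤ) * X + C (-p)) (isAlgebraic_algebraMap r)
    (fun h => by rw [h, natDegree_zero] at hlin; omega) ?_ ?_ fun i => ?_
  · rw [hlin, minpoly.eq_X_sub_C', natDegree_X_sub_C]
  · have : (q : ℚ) ≠ 0 := by exact_mod_cast hq0
    simp [hr]
    field_simp
    ring
  · rw [coeff_add, coeff_C_mul]
    rcases i with _ | _ | i
    · rw [coeff_X_zero, mul_zero, zero_add, coeff_C_zero, Int.natAbs_neg]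
      exact hpB
    · rw [coeff_X_one, mul_one, coeff_C_succ, add_zero]
      exact hqB
    · rw [coeff_X_of_ne_one (by omega), mul_zero, coeff_C_succ, add_zero]
      exact Nat.zero_le B

theorem den_le_height (r : ℚ) : r.den ≤ height r := by
  have halg : IsAlgebraic ℚ r := isAlgebraic_algebraMap r
  have h := natAbs_coeff_intMinpoly_le r (intMinpoly r).natDegree
  have h0 := leadingCoeff_ne_zero.mpr (intMinpoly_ne_zero halg)
  refine le_trans (Nat.le_of_dvd (Int.natAbs_pos.mpr h0) ?_) h
  rw [← Rat.isFractionRingDen, Int.natAbs_dvd_natAbs]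
  exact den_dvd_of_is_root (aeval_intMinpoly halg)

/-- The difference forces `q'` to divide `r.den * q`; as q ≤ √q', this leaves r.den ≥ √q'. No
fraction need be in lowest terms. -/
theorem le_sq_height_of_sub_eq {r s : ℚ} {p : ℤ} {q q' : ℕ} (hq : 1 ≤ q) (hq' : 1 ≤ q')
    (hs : s = p / q) (h : r - s = 1 / q') (hqq : q ^ 2 ≤ q') : q' ≤ height r ^ 2 := by
  have hq0 : (q : ℚ) ≠ 0 := by exact_mod_cast (by omega : q ≠ 0)
  have hq'0 : (q' : ℚ) ≠ 0 := by exact_mod_cast (by omega : q' ≠ 0)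
  have hd0 : (r.den : ℚ) ≠ 0 := by exact_mod_cast r.den_nz
  have h1 : ((q' * (r.num * q - p * r.den) : ℤ) : ℚ) = ((r.den * q : ℕ) : ℤ) := by
    have h2 : (r.num : ℚ) / r.den - p / q = 1 / q' := by rw [Rat.num_div_den, ← hs, h]
    field_simp at h2
    push_cast
    linear_combination h2
  have h3 : (q' : ℤ) ∣ ((r.den * q : ℕ) : ℤ) := ⟨_, (by exact_mod_cast h1.symm)⟩
  have h4 : q' ≤ r.den * q := Nat.le_of_dvd (Nat.mul_pos r.den_pos hq) (by exact_mod_cast h3)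
  have h5 : q' * q' ≤ r.den ^ 2 * q' := by
    calc q' * q' ≤ (r.den * q) * (r.den * q) := Nat.mul_le_mul h4 h4
      _ = r.den ^ 2 * q ^ 2 := by ring
      _ ≤ _ := Nat.mul_le_mul_left _ hqq
  exact (Nat.le_of_mul_le_mul_right h5 hq').trans (Nat.pow_le_pow_left (den_le_height r) 2)

/-- The properties of the partial sums `r k` of a lacunary series `ξ = ∑ a ^ (- u k)`. -/
structure LacunarySums (a : ℕ) (ξ : ℝ) (u : ℕ → ℕ) (r : ℕ → ℚ) : Prop where
  three_le : ∀ k, 3 ≤ u k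
  two_mul_le : ∀ k, 2 * u k ≤ u (k + 1)
  tendsto_div : Tendsto (fun k => (u (k + 1) : ℝ) / u k) atTop atTop
  nonneg : ∀ k, 0 ≤ r k
  eq_div : ∀ k, ∃ p : ℤ, r k = p / (a ^ u k : ℕ)
  sub_eq : ∀ k, r (k + 1) - r k = 1 / (a ^ u (k + 1) : ℕ)
  lt : ∀ k, (r k : ℝ) < ξ
  sub_le : ∀ k, ξ - r k ≤ 2 / ((a ^ u (k + 1) : ℕ) : ℝ)
  le_pow : ∀ k, ξ ≤ ((a ^ u k : ℕ) : ℝ)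

theorem exists_lacunarySums {a : ℕ} (ha : 2 ≤ a) {v : ℕ → ℕ} (hv : ∀ n, 0 < v n)
    (hlim : Tendsto (fun n => (v (n + 1) : ℝ) / (v n : ℝ)) atTop atTop) :
    ∃ u r, LacunarySums a (∑' n, ((a : ℝ) ^ v n)⁻¹) u r := by
  have ha' : (2 : ℝ) ≤ a := by exact_mod_cast ha
  have ha0 : (a : ℝ) ≠ 0 := by linarith
  have ha0' : (a : ℚ) ≠ 0 := by exact_mod_cast ha0
  obtain ⟨N₀, hN₀⟩ := eventually_atTop.mp (hlim.eventually_ge_atTop 2)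
  have hdouble : ∀ n, N₀ ≤ n → 2 * v n ≤ v (n + 1) := fun n hn => by
    have h := hN₀ n hn
    rw [le_div_iff₀ (by exact_mod_cast hv n)] at h
    exact_mod_cast h
  have hadd : ∀ n, N₀ ≤ n → ∀ j, v n + j ≤ v (n + j) := fun n hn j => by
    induction j with
    | zero => simp
    | succ j ih =>
      have := hdouble (n + j) (by omega)
      have := hv (n + j)
      rw [← add_assoc n j 1]
      omega
  have htend : Tendsto v atTop atTop := by
    refine tendsto_atTop.mpr fun b => ?_
    filter_upwards [eventually_ge_atTop (N₀ + b)] with n hn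
    obtain ⟨j, rfl⟩ := Nat.exists_eq_add_of_le hn
    have := hadd N₀ le_rfl (b + j)
    rw [← add_assoc N₀] at this
    omega
  set ξ := ∑' n, ((a : ℝ) ^ v n)⁻¹ with hξ
  have hpow : Tendsto (fun n => ((a ^ v n : ℕ) : ℝ)) atTop atTop :=
    tendsto_natCast_atTop_atTop.comp ((tendsto_pow_atTop_atTop_of_one_lt ha).comp htend)
  -- Early `v j` may be unordered. From `N` on, `v n` dominates all earlier exponents, so a^{v n} is
  -- a common denominator of the partial sum through index `n`.
  obtain ⟨N, hN⟩ := eventually_atTop.mp ((eventually_ge_atTop N₀).and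
    ((htend.eventually_ge_atTop 3).and ((hpow.eventually_ge_atTop ξ).and
    ((eventually_all_finset (Finset.range (N₀ + 1))).mpr
      fun j _ => htend.eventually_ge_atTop (v j)))))
  have hmono : ∀ n, N ≤ n → ∀ j, j ≤ n → v j ≤ v n := fun n hn j hj => by
    rcases le_or_gt j N₀ with h | h
    · exact (hN n hn).2.2.2 j (Finset.mem_range.mpr (by omega))
    · obtain ⟨i, rfl⟩ := Nat.exists_eq_add_of_le hj
      have := hadd j h.le i
      omega
  have htail : ∀ n, N₀ ≤ n → ∀ j, ((a : ℝ) ^ v (j + n))⁻¹ ≤ ((a : ℝ) ^ v n)⁻¹ * (1 / 2) ^ j := by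
    intro n hn j
    rw [one_div, inv_pow, ← mul_inv]
    refine inv_anti₀ (by positivity) ?_
    rw [add_comm j n]
    calc (a : ℝ) ^ v n * 2 ^ j ≤ (a : ℝ) ^ v n * (a : ℝ) ^ j := by gcongr
      _ = (a : ℝ) ^ (v n + j) := (pow_add _ _ _).symm
      _ ≤ (a : ℝ) ^ v (n + j) := pow_le_pow_right₀ (by linarith) (hadd n hn j)
  have hgeom : ∀ n, Summable fun j => ((a : ℝ) ^ v n)⁻¹ * (1 / 2) ^ j := fun n =>
    summable_geometric_two.mul_left _
  have hsumN : ∀ n, N₀ ≤ n → Summable fun j => ((a : ℝ) ^ v (j + n))⁻¹ := fun n hn =>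
    Summable.of_nonneg_of_le (fun j => by positivity) (htail n hn) (hgeom n)
  have hsum : Summable fun n => ((a : ℝ) ^ v n)⁻¹ := (summable_nat_add_iff N₀).mp (hsumN N₀ le_rfl)
  have hsplit : ∀ n, ξ - ∑ j ∈ Finset.range n, ((a : ℝ) ^ v j)⁻¹ =
      ∑' j, ((a : ℝ) ^ v (j + n))⁻¹ := fun n => by
    rw [hξ, ← hsum.sum_add_tsum_nat_add n, add_sub_cancel_left]
  have hcast : ∀ n, ((∑ j ∈ Finset.range n, ((a : ℚ) ^ v j)⁻¹ : ℚ) : ℝ) =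
      ∑ j ∈ Finset.range n, ((a : ℝ) ^ v j)⁻¹ := fun n => by push_cast; rfl
  refine ⟨fun k => v (N + k), fun k => ∑ j ∈ Finset.range (N + k + 1), ((a : ℚ) ^ v j)⁻¹,
    fun k => (hN _ (by omega)).2.1, fun k => hdouble _ (hN _ (by omega)).1, ?_,
    fun k => by positivity, fun k => ?_, fun k => ?_, fun k => ?_, fun k => ?_,
    fun k => (hN _ (by omega)).2.2.1⟩
  · refine (hlim.comp (tendsto_add_atTop_nat N)).congr fun k => ?_
    simp only [Function.comp_apply]
    rw [show k + N + 1 = N + (k + 1) by omega, add_comm k N]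
  · refine ⟨∑ j ∈ Finset.range (N + k + 1), (a : ℤ) ^ (v (N + k) - v j), ?_⟩
    push_cast
    rw [Finset.sum_div]
    refine Finset.sum_congr rfl fun j hj => ?_
    have hj' := hmono (N + k) (by omega) j (by have := Finset.mem_range.mp hj; omega)
    rw [pow_sub₀ _ ha0' hj']
    field_simp
  · rw [show N + (k + 1) + 1 = (N + k + 1) + 1 by omega, Finset.sum_range_succ,
      add_sub_cancel_left, one_div, show N + (k + 1) = N + k + 1 by omega, Nat.cast_pow]
  · rw [hcast, ← sub_pos, hsplit]
    exact (hsumN _ (by have := (hN N le_rfl).1; omega)).tsum_pos (fun j => by positivity) 0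
      (by positivity)
  · have hn : N₀ ≤ N + k + 1 := by have := (hN N le_rfl).1; omega
    rw [hcast, hsplit]
    calc ∑' j, ((a : ℝ) ^ v (j + (N + k + 1)))⁻¹
        ≤ ∑' j, ((a : ℝ) ^ v (N + k + 1))⁻¹ * (1 / 2) ^ j :=
          (hsumN _ hn).tsum_le_tsum (htail _ hn) (hgeom _)
      _ = 2 / ((a ^ v (N + (k + 1)) : ℕ) : ℝ) := by
          rw [tsum_mul_left, tsum_geometric_two, ← add_assoc, Nat.cast_pow, div_eq_inv_mul]

namespace LacunarySums

variable {a : ℕ} {ξ : ℝ} {u : ℕ → ℕ} {r : ℕ → ℚ}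

theorem strictMono (h : LacunarySums a ξ u r) (ha : 2 ≤ a) : StrictMono r :=
  strictMono_nat_of_lt_succ fun k => by
    rw [← sub_pos, h.sub_eq k]
    have : 0 < a ^ u (k + 1) := by positivity
    positivity

theorem tendsto_pow (h : LacunarySums a ξ u r) (ha : 2 ≤ a) :
    Tendsto (fun k => ((a ^ u k : ℕ) : ℝ)) atTop atTop := by
  have hu : StrictMono u := strictMono_nat_of_lt_succ fun k => by
    have := h.two_mul_le k
    have := h.three_le k
    omega
  exact tendsto_natCast_atTop_atTop.comp
    ((tendsto_pow_atTop_atTop_of_one_lt ha).comp hu.tendsto_atTop)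

theorem eventually_pow_le (h : LacunarySums a ξ u r) (ha : 2 ≤ a) (w : ℕ) :
    ∀ᶠ k in atTop, ((a ^ u k : ℕ) : ℝ) ^ w ≤ ((a ^ u (k + 1) : ℕ) : ℝ) := by
  filter_upwards [h.tendsto_div.eventually_ge_atTop (w : ℝ)] with k hk
  have h3 := h.three_le k
  rw [le_div_iff₀ (by exact_mod_cast (by omega : 0 < u k))] at hk
  have hk' : w * u k ≤ u (k + 1) := by exact_mod_cast hk
  rw [← Nat.cast_pow, ← pow_mul, mul_comm]
  exact_mod_cast Nat.pow_le_pow_right (by omega) hk'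

theorem liouville (h : LacunarySums a ξ u r) (ha : 2 ≤ a) : Liouville ξ := by
  intro n
  -- The spare power of a^{u k} > 2 absorbs the constant 2 in the error.
  obtain ⟨k, h1, h2⟩ := ((h.eventually_pow_le ha (n + 1)).and
    ((h.tendsto_pow ha).eventually_gt_atTop 2)).exists
  obtain ⟨p, hp⟩ := h.eq_div k
  have hr : (r k : ℝ) = (p : ℝ) / (((a ^ u k : ℕ) : ℤ) : ℝ) := by
    rw [hp, Int.cast_natCast]
    push_cast
    rfl
  have hlt := h.lt k
  refine ⟨p, ((a ^ u k : ℕ) : ℤ), ?_, ?_, ?_⟩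
  · have : 2 < a ^ u k := by exact_mod_cast h2
    omega
  · rw [← hr]
    exact hlt.ne'
  · rw [← hr, abs_of_pos (sub_pos.mpr hlt), Int.cast_natCast]
    refine (h.sub_le k).trans_lt ?_
    set Q := ((a ^ u k : ℕ) : ℝ)
    have hQ : 0 < Q := by linarith
    rw [div_lt_div_iff₀ (lt_of_lt_of_le (by positivity) h1) (by positivity), one_mul]
    refine lt_of_lt_of_le ?_ h1
    rw [pow_succ']
    gcongr

/-- The numerator is r_k q_k ≤ ξ q_k ≤ q_k². -/
theorem height_le (h : LacunarySums a ξ u r) (ha : 2 ≤ a) (k : ℕ) :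
    height (r k) ≤ a ^ (2 * u k) := by
  obtain ⟨p, hp⟩ := h.eq_div k
  have hq : 1 ≤ a ^ u k := Nat.one_le_pow _ _ (by omega)
  have hq' : (0 : ℚ) < (a ^ u k : ℕ) := by exact_mod_cast hq
  refine height_ratCast_le hq hp (Nat.pow_le_pow_right (by omega) (by omega)) ?_
  have h1 : (p : ℚ) = r k * (a ^ u k : ℕ) := by rw [hp, div_mul_cancel₀ _ hq'.ne']
  have h2 : 0 ≤ p := by
    have : (0 : ℚ) ≤ p := by rw [h1]; exact mul_nonneg (h.nonneg k) hq'.le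
    exact_mod_cast this
  have h3 : r k ≤ (a ^ u k : ℕ) := by
    have := (h.lt k).le.trans (h.le_pow k)
    exact_mod_cast this
  have h4 : (p : ℚ) ≤ ((a ^ (2 * u k) : ℕ) : ℤ) := by
    rw [h1, two_mul, pow_add]
    push_cast at h3 hq' ⊢
    gcongr
  have h5 : p ≤ ((a ^ (2 * u k) : ℕ) : ℤ) := by exact_mod_cast h4
  omega

theorem pow_le_height_sq (h : LacunarySums a ξ u r) (ha : 2 ≤ a) (k : ℕ) :
    a ^ u (k + 1) ≤ height (r (k + 1)) ^ 2 := by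
  obtain ⟨p, hp⟩ := h.eq_div k
  refine le_sq_height_of_sub_eq (Nat.one_le_pow _ _ (by omega)) (Nat.one_le_pow _ _ (by omega)) hp
    (h.sub_eq k) ?_
  rw [← pow_mul, mul_comm]
  exact Nat.pow_le_pow_right (by omega) (h.two_mul_le k)

theorem mem_classL (h : LacunarySums a ξ u r) (ha : 2 ≤ a) : ξ ∈ classL := by
  have ha' : (2 : ℝ) ≤ a := by exact_mod_cast ha
  have ha0 : (0 : ℝ) < a := by linarith
  have hu : ∀ k, (0 : ℝ) < u k := fun k => by
    exact_mod_cast (by have := h.three_le k; omega : 0 < u k)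
  have hH1 : ∀ k, (1 : ℝ) ≤ height (r k) := fun k => by
    exact_mod_cast one_le_height (isAlgebraic_algebraMap (r k))
  have hupper : ∀ k, (height (r k) : ℝ) ≤ (a : ℝ) ^ (2 * u k : ℝ) := fun k => by
    have := h.height_le ha k
    have h1 : (2 * u k : ℝ) = ((2 * u k : ℕ) : ℝ) := by push_cast; rfl
    rw [h1, Real.rpow_natCast]
    exact_mod_cast this
  have hlower : ∀ k, (a : ℝ) ^ (u (k + 1) / 2 : ℝ) ≤ height (r (k + 1)) := fun k => by
    have := h.pow_le_height_sq ha k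
    have h1 : (a : ℝ) ^ u (k + 1) ≤ (height (r (k + 1)) : ℝ) ^ 2 := by exact_mod_cast this
    refine le_of_sq_le_sq ?_ (by positivity)
    rwa [← Real.rpow_natCast, ← Real.rpow_mul ha0.le, Nat.cast_ofNat,
      div_mul_cancel₀ _ two_ne_zero, Real.rpow_natCast]
  -- The shift is due to the lower height bound, which needs a preceding term. From H ≤
  -- a^{2u_{k+1}}, this ω gives H^ω ≤ a^{u_{k+2}/2}, less than the inverse error a^{u_{k+2}}/2
  -- because u ≥ 3. From H ≥ a^{u_{k+1}/2}, the constant 16 gives H^{16ω} ≥ a^{2u_{k+2}}, which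
  -- bounds the next height.
  refine ⟨h.liouville ha, fun k => u (k + 2) / (4 * u (k + 1)), fun k => r (k + 1), fun k => ?_,
    ?_, (h.strictMono ha).injective.comp (add_left_injective 1), fun k => ?_, 16, by norm_num,
    fun k => ?_⟩
  · have := hu (k + 2)
    have := hu (k + 1)
    positivity
  · refine ((h.tendsto_div.comp (tendsto_add_atTop_nat 1)).atTop_div_const
      (by norm_num : (0 : ℝ) < 4)).congr fun k => ?_
    simp only [Function.comp_apply]
    rw [div_div, mul_comm]
  · have h1 := hu (k + 1)
    have h2 := hu (k + 2)
    rw [abs_of_pos (sub_pos.mpr (h.lt _)), Real.rpow_neg (by positivity)]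
    refine (h.sub_le _).trans_lt ?_
    have h3 : (height (r (k + 1)) : ℝ) ^ (u (k + 2) / (4 * u (k + 1)) : ℝ) ≤
        (a : ℝ) ^ (u (k + 2) / 2 : ℝ) := by
      calc _ ≤ ((a : ℝ) ^ (2 * u (k + 1) : ℝ)) ^ (u (k + 2) / (4 * u (k + 1)) : ℝ) := by
            gcongr
            exact hupper _
        _ = _ := by
            rw [← Real.rpow_mul ha0.le]
            congr 1
            field_simp
            norm_num
    refine lt_of_lt_of_le ?_ (inv_anti₀ (Real.rpow_pos_of_pos (by linarith [hH1 (k + 1)]) _) h3)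
    have h4 : ((a ^ u (k + 1 + 1) : ℕ) : ℝ) =
        (a : ℝ) ^ (u (k + 2) / 2 : ℝ) * (a : ℝ) ^ (u (k + 2) / 2 : ℝ) := by
      rw [← Real.rpow_add ha0, add_halves, Real.rpow_natCast]
      push_cast
      rfl
    have h5 : 2 < (a : ℝ) ^ (u (k + 2) / 2 : ℝ) := by
      have h6 : (3 : ℝ) ≤ u (k + 2) := by exact_mod_cast h.three_le _
      calc (2 : ℝ) = 2 ^ (1 : ℝ) := (Real.rpow_one 2).symm
        _ < 2 ^ (u (k + 2) / 2 : ℝ) := Real.rpow_lt_rpow_of_exponent_lt one_lt_two (by linarith)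
        _ ≤ _ := by gcongr
    rw [h4, div_lt_iff₀ (by positivity), ← mul_assoc, inv_mul_cancel₀ (by positivity), one_mul]
    exact h5
  · have h1 := hu (k + 1)
    have h2 := hu (k + 2)
    calc (height (r (k + 1 + 1)) : ℝ) ≤ (a : ℝ) ^ (2 * u (k + 2) : ℝ) := hupper _
      _ = ((a : ℝ) ^ (u (k + 1) / 2 : ℝ)) ^ (16 * (u (k + 2) / (4 * u (k + 1))) : ℝ) := by
          rw [← Real.rpow_mul ha0.le]
          congr 1
          field_simp
          norm_num
      _ ≤ _ := by
          gcongr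
          exact hlower k

end LacunarySums

end Series

end UNumbers

end

theorem corollary1 (a : ℕ) (ha : 2 ≤ a) (v : ℕ → ℕ) (hv : ∀ n, 0 < v n)
    (hlim : Tendsto (fun n => (v (n + 1) : ℝ) / (v n : ℝ)) atTop atTop)
    (ξ : ℝ) (hξ : ξ = ∑' n, ((a : ℝ) ^ v n)⁻¹) :
    ξ ∈ UNumbers.classL ∧
      ∀ (𝕜 : Type*) [RCLike 𝕜] (K : Type*) [Field K] [NumberField K] (σ : K →+* 𝕜)
        (m : ℕ) (_ : Module.finrank ℚ K = m)
        (F : RatFunc K) (_ : ∀ c : K, F ≠ RatFunc.C c) (_ : UNumbers.coeffField F = ⊤),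
        F.denom.eval₂ σ (ξ : 𝕜) ≠ 0 ∧
          UNumbers.IsUNumber m (F.num.eval₂ σ (ξ : 𝕜) / F.denom.eval₂ σ (ξ : 𝕜)) := by
  obtain ⟨u, r, h⟩ := UNumbers.exists_lacunarySums ha hv hlim
  rw [← hξ] at h
  have htr : Transcendental ℤ ξ := (h.liouville ha).transcendental
  refine ⟨h.mem_classL ha, fun 𝕜 _ K _ _ σ m hm F hF hFK =>
    ⟨UNumbers.eval₂_ne_zero_of_transcendental σ htr F.denom_ne_zero, ?_⟩⟩
  rw [← hm]
  refine UNumbers.isUNumber_eval₂_div σ hF hFK htr (h.strictMono ha).injective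
    (fun k => Nat.one_le_pow _ _ (by omega)) (h.tendsto_pow ha) (h.eventually_pow_le ha) h.eq_div
    (c := 2) fun k => ?_
  rw [abs_of_pos (sub_pos.mpr (h.lt k))]
  exact h.sub_le k
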